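/- Let $j\in\mathbb N$, and let $\mathbb P(\mathbb R^j)$ be the space of lines through the origin of $\mathbb R^j$, with the Riemannian metric $\langle\cdot,\cdot\rangle$ for which the canonical projection from the unit sphere of $\mathbb R^j$ is a local isometry. Let $d_R(x,y)\in[0,\pi/2]$ be the angle between the lines $x$ and $y$, let $d_{\mathbb P}=\sin d_R$, and write $d_{\mathbb P}(x,\mathcal N)=\inf_{y\in\mathcal N}d_{\mathbb P}(x,y)$. Let $\mathcal N$ be a (not necessarily closed) embedded $C^2$ submanifold without boundary of $\mathbb P(\mathbb R^j)$. Let $\mathcal U$ be the largest open subset of $\mathbb P(\mathbb R^j)$ such that for every $x\in\mathcal U$ there is a unique $y\in\mathcal N$ with $d_{\mathbb P}(x,y)\le d_{\mathbb P}(x,y')$ for all $y'\in\mathcal N$. Then the function $$\alpha(x)=d_{\mathbb P}(x,\mathcal N)^{-2}$$ is self-convex on $\mathcal U\setminus\mathcal N$. That is, $\mathcal U\setminus\mathcal N$ is open, $\alpha$ is positive and of class $C^2$ on it, and, for every open interval $I$ and every geodesic $\gamma:I\to\mathcal U\setminus\mathcal N$ of the Riemannian metric $\alpha(x)\langle\cdot,\cdot\rangle_x$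 on $\mathcal U\setminus\mathcal N$, the function $t\mapsto\log\alpha(\gamma(t))$ is convex on $I$. -/

import Mathlib

open scoped LinearAlgebra.Projectivization

noncomputable section

namespace ProjectiveSelfConvexity

/-! ### Coordinate expressions on a real normed space -/

section Coordinates

variable {E : Type*} [NormedAddCommGroup E] [NormedSpace ℝ E]

/-- `S` is a `C²` (embedded) submanifold without boundary of `E`: around each of its points, a
`C²` diffeomorphism between open subsets of `E` maps `S` to a linear subspace. `S` need not be
closed, and the dimension is allowed to vary from one connected component to another. -/
def IsC2SubmanifoldOfSpace (S : Set E) : Prop :=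
  ∀ p ∈ S, ∃ (F : Submodule ℝ E) (Φ : OpenPartialHomeomorph E E),
    p ∈ Φ.source ∧ ContDiffOn ℝ 2 Φ Φ.source ∧ ContDiffOn ℝ 2 Φ.symm Φ.target ∧
      ∀ q ∈ Φ.source, q ∈ S ↔ Φ q ∈ F

/-- Christoffel symbols of the first kind at `p` of the metric tensor `g`, where `g q u w` is the
inner product of `u` and `w` at `q`:
`Γ(u₁, u₂; w) = (∂_{u₁} g(u₂, w) + ∂_{u₂} g(u₁, w) - ∂_w g(u₁, u₂)) / 2`. -/
def christoffel (g : E → E → E → ℝ) (p u₁ u₂ w : E) : ℝ :=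
  (fderiv ℝ (fun q => g q u₂ w) p u₁ + fderiv ℝ (fun q => g q u₁ w) p u₂
    - fderiv ℝ (fun q => g q u₁ u₂) p w) / 2

/-- The geodesic equation `∇_{c'} c' = 0` at time `t`, with its index lowered by `g`:
`g(c'', w) + Γ(c', c'; w) = 0` for all `w`. -/
def SatisfiesGeodesicEquationAt (g : E → E → E → ℝ) (c : ℝ → E) (t : ℝ) : Prop :=
  ∀ w : E, g (c t) (deriv (deriv c) t) w + christoffel g (c t) (deriv c t) (deriv c t) w = 0

end Coordinates

/-! ### The real projective space `ℙ(ℝʲ)` -/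

/-- Points of `ℙ(ℝʲ)` are the lines through the origin in `ℝʲ`. -/
abbrev Proj (j : ℕ) : Type := ℙ ℝ (EuclideanSpace ℝ (Fin j))

variable {j : ℕ}

/-- The quotient topology from the nonzero vectors. -/
instance projTopology : TopologicalSpace (Proj j) :=
  TopologicalSpace.coinduced
    (Projectivization.mk' ℝ : {v : EuclideanSpace ℝ (Fin j) // v ≠ 0} → Proj j) inferInstance

/-- `d_R`: the angle, in `[0, π/2]`, between two lines. -/
def dR (x y : Proj j) : ℝ :=
  Real.arccos (|inner ℝ x.rep y.rep| / (‖x.rep‖ * ‖y.rep‖))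

/-- `d_ℙ = sin d_R`. -/
def dP (x y : Proj j) : ℝ := Real.sin (dR x y)

/-- `d_ℙ(x, N)`. -/
def dPSet (x : Proj j) (N : Set (Proj j)) : ℝ := sInf (dP x '' N)

/-- `y` is a point of `N` closest to `x` for `d_ℙ`. -/
def IsClosestPoint (N : Set (Proj j)) (x y : Proj j) : Prop :=
  y ∈ N ∧ ∀ y' ∈ N, dP x y ≤ dP x y'

/-- The largest open set all of whose points have a unique closest point in `N`. -/
def uniqueClosestRegion (N : Set (Proj j)) : Set (Proj j) :=
  interior {x | ∃! y, IsClosestPoint N x y}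

/-! ### The affine charts -/

/-- Unit vectors of `ℝʲ`; they index the affine charts. -/
abbrev UnitVec (j : ℕ) : Type := Metric.sphere (0 : EuclideanSpace ℝ (Fin j)) 1

/-- The orthogonal complement of `z`. -/
abbrev Perp (z : UnitVec j) : Type := ↥(ℝ ∙ (z : EuclideanSpace ℝ (Fin j)))ᗮ

theorem inner_add_perp (z : UnitVec j) (v : Perp z) :
    inner ℝ (z : EuclideanSpace ℝ (Fin j)) ((z : EuclideanSpace ℝ (Fin j)) + v) = 1 := by
  have h1 : ‖(z : EuclideanSpace ℝ (Fin j))‖ = 1 := by simp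
  rw [inner_add_right, real_inner_self_eq_norm_sq, h1,
    Submodule.mem_orthogonal_singleton_iff_inner_right.1 v.2]
  norm_num

theorem add_perp_ne_zero (z : UnitVec j) (v : Perp z) :
    (z : EuclideanSpace ℝ (Fin j)) + v ≠ 0 := by
  intro h
  have := inner_add_perp z v
  rw [h, inner_zero_right] at this
  exact zero_ne_one this

theorem add_proj_perp_of_inner_eq_one (z : UnitVec j) {y : EuclideanSpace ℝ (Fin j)}
    (hy : inner ℝ (z : EuclideanSpace ℝ (Fin j)) y = 1) :
    (z : EuclideanSpace ℝ (Fin j)) +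
      ((ℝ ∙ (z : EuclideanSpace ℝ (Fin j)))ᗮ.orthogonalProjectionOnto y : Perp z) = y := by
  have h1 : ‖(z : EuclideanSpace ℝ (Fin j))‖ = 1 := by simp
  have h2 := (ℝ ∙ (z : EuclideanSpace ℝ (Fin j))).starProjection_add_starProjection_orthogonal y
  rw [Submodule.starProjection_unit_singleton ℝ h1, hy, one_smul] at h2
  exact h2

/-- The affine chart centred at `z`, defined on the lines not orthogonal to `z`. Its inverse is
`v ↦ [z + v]`, for `v` orthogonal to `z`. These charts are a smooth atlas of `ℙ(ℝʲ)`. -/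
def affineChart (z : UnitVec j) : PartialEquiv (Proj j) (Perp z) where
  toFun x := (ℝ ∙ (z : EuclideanSpace ℝ (Fin j)))ᗮ.orthogonalProjectionOnto
    ((inner ℝ (z : EuclideanSpace ℝ (Fin j)) x.rep)⁻¹ • x.rep)
  invFun v := Projectivization.mk ℝ ((z : EuclideanSpace ℝ (Fin j)) + v) (add_perp_ne_zero z v)
  source := {x | inner ℝ (z : EuclideanSpace ℝ (Fin j)) x.rep ≠ 0}
  target := Set.univ
  map_source' _ _ := Set.mem_univ _
  map_target' v _ := by
    obtain ⟨a, ha⟩ := Projectivization.exists_smul_eq_mk_rep ℝ _ (add_perp_ne_zero z v)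
    rw [Set.mem_ofPred_eq, ← ha, Units.smul_def, inner_smul_right, inner_add_perp, mul_one]
    exact a.ne_zero
  left_inv' x hx := by
    refine Eq.trans ?_ x.mk_rep
    rw [Projectivization.mk_eq_mk_iff']
    exact ⟨_, (add_proj_perp_of_inner_eq_one z (by
      rw [inner_smul_right, inv_mul_cancel₀ hx])).symm⟩
  right_inv' v _ := by
    obtain ⟨a, ha⟩ := Projectivization.exists_smul_eq_mk_rep ℝ _ (add_perp_ne_zero z v)
    rw [← ha, Units.smul_def, inner_smul_right, inner_add_perp, mul_one, smul_smul,
      inv_mul_cancel₀ a.ne_zero, one_smul]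
    exact Subtype.ext (add_left_cancel (add_proj_perp_of_inner_eq_one z (inner_add_perp z v)))

/-! ### The Riemannian structure of `ℙ(ℝʲ)` -/

/-- The local section `v ↦ (z + v) / ‖z + v‖` of the projection of the unit sphere onto
`ℙ(ℝʲ)`, in the affine chart centred at `z`. -/
def sphereSection (z : UnitVec j) (v : Perp z) : EuclideanSpace ℝ (Fin j) :=
  ‖(z : EuclideanSpace ℝ (Fin j)) + v‖⁻¹ • ((z : EuclideanSpace ℝ (Fin j)) + v)

/-- The standard Riemannian metric of `ℙ(ℝʲ)` in the affine charts: the metric for which the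
projection of the unit sphere onto `ℙ(ℝʲ)` is a local isometry. -/
def stdMetric (z : UnitVec j) (v u w : Perp z) : ℝ :=
  inner ℝ (fderiv ℝ (sphereSection z) v u) (fderiv ℝ (sphereSection z) v w)

/-- The condition metric `α ⟨·, ·⟩` in the affine charts. -/
def conditionMetric (α : Proj j → ℝ) (z : UnitVec j) (v u w : Perp z) : ℝ :=
  α ((affineChart z).symm v) * stdMetric z v u w

/-- `γ` is a geodesic, on the open interval `I`, of the metric on an open set of `ℙ(ℝʲ)` whose
expression in the affine charts is `g`: it is a `C²` curve which satisfies the geodesic equation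
in the affine charts. -/
structure IsGeodesicOn (g : ∀ z : UnitVec j, Perp z → Perp z → Perp z → ℝ)
    (γ : ℝ → Proj j) (I : Set ℝ) : Prop where
  continuousOn : ContinuousOn γ I
  contDiffOn : ∀ z : UnitVec j,
    ContDiffOn ℝ 2 (fun t => affineChart z (γ t)) (I ∩ γ ⁻¹' (affineChart z).source)
  geodesicEquation : ∀ (z : UnitVec j), ∀ t ∈ I, γ t ∈ (affineChart z).source →
    SatisfiesGeodesicEquationAt (g z) (fun s => affineChart z (γ s)) t

/-- `α` is self-convex on the open set `W` of `ℙ(ℝʲ)`: it is positive and of class `C²` on `W`,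
and `log α` is convex along every geodesic in `W` of the condition metric `α ⟨·, ·⟩`. -/
structure IsSelfConvexOn (α : Proj j → ℝ) (W : Set (Proj j)) : Prop where
  isOpen : IsOpen W
  pos : ∀ x ∈ W, 0 < α x
  contDiffOn : ∀ z : UnitVec j,
    ContDiffOn ℝ 2 (fun v => α ((affineChart z).symm v)) ((affineChart z).symm ⁻¹' W)
  convexOn : ∀ (γ : ℝ → Proj j) (I : Set ℝ), IsOpen I → I.OrdConnected → Set.MapsTo γ I W →
    IsGeodesicOn (conditionMetric α) γ I → ConvexOn ℝ I (fun t => Real.log (α (γ t)))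

/-- `N` is a `C²` submanifold without boundary of `ℙ(ℝʲ)`: it is one in each affine chart. -/
def IsC2Submanifold (N : Set (Proj j)) : Prop :=
  ∀ z : UnitVec j, IsC2SubmanifoldOfSpace ((affineChart z).symm ⁻¹' N)

end ProjectiveSelfConvexity

end

noncomputable section

open Filter Topology Metric
open scoped LinearAlgebra.Projectivization

/-! ### Nearest points of a not necessarily closed set: continuity and prolongation -/

namespace NearestPoint

variable {E : Type*} [NormedAddCommGroup E]

/-! The sine of the angle between two lines is the Euclidean distance from a unit vector on one to
the other line (`norm_mul_dP_mk`). So, over `uniqueClosestRegion N`, `dPSet` at the line of a unit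
vector `X` is the distance from `X` to the cone over `N`, and the problem becomes Euclidean.

Convexity comes from a barrier. Let `X` be the lift of the geodesic to the unit sphere, `r` its
squared distance to the cone, and `p` the nearest point at time `t`. Frozen in time, `p` gives `r ≤
‖X - p‖ ^ 2` with equality at `t`, hence `r'' ≤ 2 (⟨X - p, X''⟩ + ‖X'‖ ^ 2)`. The geodesic equation
of `r⁻¹ ⟨·, ·⟩`, tested on the tangential part `X - p - r X` of half the gradient, turns `r` times
the right side into exactly `r' ^ 2`, the spherical curvature terms cancelling since `X - p` is
orthogonal to `p`. Thus `r r'' ≤ r' ^ 2`, which is convexity of `-log r` (`mul_deriv_deriv_le_sq`,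
`log_condition_along_geodesic`).

The argument needs `r` to be `C²` (`contDiffAt_infDist_sq`). Where nearest points are unique on an
open set, a minimizing segment can be prolonged beyond its endpoint
(`exists_isNearest_prolongation`). This makes the second order condition at the nearest point
strict, so the implicit function theorem shows that the projection `P` is `C¹`; the gradient `2 (x -
P x)` is then `C¹`. Closedness of `N` is replaced by `mem_of_nearest_in_closure`. -/

/-- `p` is a point of `S` nearest to `x`. -/
def IsNearest (S : Set E) (x p : E) : Prop :=
  p ∈ S ∧ ∀ q ∈ S, ‖x - p‖ ≤ ‖x - q‖

theorem IsNearest.infDist_eq {S : Set E} {x p : E} (h : IsNearest S x p) :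
    infDist x S = ‖x - p‖ := by
  refine le_antisymm ((infDist_le_dist_of_mem h.1).trans_eq (dist_eq_norm _ _)) ?_
  refine (le_infDist ⟨p, h.1⟩).2 fun {_} hq => ?_
  rw [dist_eq_norm]
  exact h.2 _ hq

theorem isNearest_of_infDist_eq {S : Set E} {x p : E} (hp : p ∈ S)
    (h : ‖x - p‖ ≤ infDist x S) : IsNearest S x p :=
  ⟨hp, fun _ hq => h.trans ((infDist_le_dist_of_mem hq).trans_eq (dist_eq_norm _ _))⟩

theorem norm_sub_le_of_mem_closure {S : Set E} {x p r : E}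
    (h : ∀ q ∈ S, ‖x - p‖ ≤ ‖x - q‖) (hr : r ∈ closure S) : ‖x - p‖ ≤ ‖x - r‖ :=
  closure_minimal (s := S) (t := {q | ‖x - p‖ ≤ ‖x - q‖}) h
    (isClosed_le continuous_const (by fun_prop)) hr

variable [InnerProductSpace ℝ E]

/-- If the points of an open set all have nearest points in `S`, then the nearest points of these
in the closure of `S` belong to `S`. -/
theorem mem_of_nearest_in_closure {S V : Set E} (hV : IsOpen V)
    (hex : ∀ x ∈ V, ∃ p, IsNearest S x p) {x p : E} (hx : x ∈ V) (hp : p ∈ closure S)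
    (hmin : ∀ q ∈ S, ‖x - p‖ ≤ ‖x - q‖) : p ∈ S := by
  have hcont : Tendsto (fun s : ℝ => x + s • (p - x)) (𝓝[>] 0) (𝓝 x) := by
    have : Continuous fun s : ℝ => x + s • (p - x) := by fun_prop
    have h0 := this.tendsto 0
    simp only [zero_smul, add_zero] at h0
    exact h0.mono_left nhdsWithin_le_nhds
  -- Move slightly from `x` towards `p`. The new point has a nearest point `r` in `S`; comparing `r`
  -- with `p` both there and at `x` gives `s ‖A - B‖ ^ 2 ≤ (s - 1) (‖B‖ ^ 2 - ‖A‖ ^ 2) ≤ 0`, so `r =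
  -- p`.
  obtain ⟨s, hsV, hs1, hs0⟩ :=
    ((hcont.eventually (hV.mem_nhds hx)).and
      ((eventually_nhdsWithin_of_eventually_nhds (gt_mem_nhds (zero_lt_one' ℝ))).and
        self_mem_nhdsWithin)).exists
  have hs0 : (0 : ℝ) < s := hs0
  obtain ⟨r, hrS, hr⟩ := hex _ hsV
  have h1 := norm_sub_le_of_mem_closure hr hp
  have h2 := hmin r hrS
  set A := p - x with hA
  set B := r - x with hB
  have e1 : x + s • A - r = s • A - B := by rw [hB]; abel
  have e2 : x + s • A - p = (s - 1) • A := by rw [hA, sub_smul, one_smul]; abel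
  have e3 : ‖x - p‖ = ‖A‖ := norm_sub_rev _ _
  have e4 : ‖x - r‖ = ‖B‖ := norm_sub_rev _ _
  rw [e1, e2] at h1
  rw [e3, e4] at h2
  have h1' : ‖s • A - B‖ ^ 2 ≤ ‖(s - 1) • A‖ ^ 2 := by gcongr
  have h2' : ‖A‖ ^ 2 ≤ ‖B‖ ^ 2 := by gcongr
  rw [norm_sub_sq_real, norm_smul, norm_smul, inner_smul_left, mul_pow, mul_pow, Real.norm_eq_abs,
    Real.norm_eq_abs, sq_abs, sq_abs] at h1'
  simp only [conj_trivial] at h1'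
  have h3 := norm_sub_sq_real A B
  have h4 : s * ‖A - B‖ ^ 2 ≤ 0 := by
    rw [h3]
    nlinarith
  have h5 : ‖A - B‖ ^ 2 ≤ 0 := nonpos_of_mul_nonpos_right h4 hs0
  have h6 : A - B = 0 := by
    rw [← norm_eq_zero]
    exact pow_eq_zero_iff (two_ne_zero) |>.1 (le_antisymm h5 (sq_nonneg _))
  have : p = r := by
    have : A - B = p - r := by rw [hA, hB]; abel
    rw [this] at h6
    exact sub_eq_zero.1 h6
  rw [this]
  exact hrS

/-- A nearest point selection is continuous on an open set on which nearest points are unique. -/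
theorem continuousAt_of_unique [FiniteDimensional ℝ E] {S V : Set E} (hV : IsOpen V) {P : E → E}
    (hP : ∀ x ∈ V, IsNearest S x (P x)) (huniq : ∀ x ∈ V, ∀ q, IsNearest S x q → q = P x)
    {x : E} (hx : x ∈ V) : ContinuousAt P x := by
  have hVx := hV.mem_nhds hx
  refine (isCompact_closedBall x (‖x - P x‖ + 2)).tendsto_nhds_of_unique_mapClusterPt ?_ ?_
  · filter_upwards [hVx, ball_mem_nhds x one_pos] with y hy hy1
    rw [mem_ball, dist_eq_norm] at hy1
    rw [mem_closedBall, dist_eq_norm]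
    have h1 := (hP y hy).2 _ (hP x hx).1
    have h2 : ‖y - P x‖ ≤ ‖y - x‖ + ‖x - P x‖ := norm_sub_le_norm_sub_add_norm_sub _ _ _
    have h3 : ‖P y - x‖ ≤ ‖P y - y‖ + ‖y - x‖ := norm_sub_le_norm_sub_add_norm_sub _ _ _
    rw [norm_sub_rev (P y) y] at h3
    linarith
  · intro p _ hp
    -- A cluster point of `P` at `x` is a priori only in the closure of `S`, but it minimizes the
    -- distance to `x`, so it belongs to `S` and uniqueness identifies it with `P x`.
    obtain ⟨U, hU, hUp⟩ := mapClusterPt_iff_ultrafilter.1 hp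
    have hUx : Tendsto (fun y : E => y) U (𝓝 x) := hU
    have hcl : p ∈ closure S :=
      mem_closure_of_tendsto hUp ((hUx.eventually hVx).mono fun y hy => (hP y hy).1)
    have hmin : ∀ q ∈ S, ‖x - p‖ ≤ ‖x - q‖ := fun q hq =>
      le_of_tendsto_of_tendsto (hUx.sub hUp).norm (hUx.sub_const q).norm
        ((hUx.eventually hVx).mono fun y hy => (hP y hy).2 q hq)
    exact huniq x hx p
      ⟨mem_of_nearest_in_closure hV (fun y hy => ⟨_, hP y hy⟩) hx hcl hmin, hmin⟩

/-- Moving away from the nearest point, the distance increases with slope close to one. -/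
theorem eventually_infDist_gt {S V : Set E} (hV : IsOpen V) {P : E → E}
    (hP : ∀ x ∈ V, IsNearest S x (P x)) {x : E} (hx : x ∈ V) (hc : ContinuousAt P x)
    (hne : x ≠ P x) {μ : ℝ} (hμ : μ < 1) :
    ∀ᶠ s : ℝ in 𝓝[>] 0,
      infDist x S + μ * (s * ‖x - P x‖) < infDist (x + s • (x - P x)) S := by
  set u := x - P x with hu
  have hu0 : 0 < ‖u‖ := norm_pos_iff.2 (sub_ne_zero.2 hne)
  have hcurve : Tendsto (fun s : ℝ => x + s • u) (𝓝[>] 0) (𝓝 x) := by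
    have : Continuous fun s : ℝ => x + s • u := by fun_prop
    have h0 := this.tendsto 0
    simp only [zero_smul, add_zero] at h0
    exact h0.mono_left nhdsWithin_le_nhds
  have hb : Tendsto (fun s : ℝ => x - P (x + s • u)) (𝓝[>] 0) (𝓝 u) :=
    tendsto_const_nhds.sub (hc.tendsto.comp hcurve)
  -- With `b = x - P (x + s • u)`, the new distance is `‖b + s • u‖` and `‖b‖` is at least the old
  -- one. Cauchy–Schwarz against `b` bounds the gain below by `s ⟨b, u⟩ / ‖b‖`, and `b → u` by
  -- continuity of `P`.
  have hlim : Tendsto (fun s : ℝ => inner ℝ (x - P (x + s • u)) u - μ * ‖u‖ * ‖x - P (x + s • u)‖)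
      (𝓝[>] 0) (𝓝 (inner ℝ u u - μ * ‖u‖ * ‖u‖)) :=
    (hb.inner tendsto_const_nhds).sub (hb.norm.const_mul _)
  have hpos : 0 < inner ℝ u u - μ * ‖u‖ * ‖u‖ := by
    rw [real_inner_self_eq_norm_sq]
    nlinarith [mul_pos hu0 hu0]
  filter_upwards [hlim.eventually (lt_mem_nhds hpos), hcurve.eventually (hV.mem_nhds hx),
    self_mem_nhdsWithin] with s hs hsV hs0
  simp only [Set.mem_Ioi] at hs0
  set b := x - P (x + s • u) with hbdef
  have hd1 : infDist (x + s • u) S = ‖b + s • u‖ := by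
    rw [(hP _ hsV).infDist_eq, hbdef]
    congr 1
    abel
  have hd0 : infDist x S ≤ ‖b‖ := by
    rw [(hP x hx).infDist_eq]
    exact (hP x hx).2 _ (hP _ hsV).1
  have hb0 : 0 < ‖b‖ := by
    rw [(hP x hx).infDist_eq] at hd0
    exact hu0.trans_le hd0
  rw [hd1]
  have hcs : inner ℝ (b + s • u) b ≤ ‖b + s • u‖ * ‖b‖ := real_inner_le_norm _ _
  rw [inner_add_left, inner_smul_left, real_inner_self_eq_norm_sq, real_inner_comm] at hcs
  simp only [conj_trivial] at hcs
  have h1 : (‖b‖ + μ * (s * ‖u‖)) * ‖b‖ < ‖b + s • u‖ * ‖b‖ := by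
    have : 0 < s * (inner ℝ b u - μ * ‖u‖ * ‖b‖) := mul_pos hs0 hs
    nlinarith
  have h2 := lt_of_mul_lt_mul_right h1 hb0.le
  linarith

/-- On an open set with unique nearest points, a segment from a nearest point can be prolonged
slightly and remains minimizing. -/
theorem exists_isNearest_prolongation [FiniteDimensional ℝ E] {S V : Set E} (hV : IsOpen V) {P : E → E}
    (hP : ∀ x ∈ V, IsNearest S x (P x)) (huniq : ∀ x ∈ V, ∀ q, IsNearest S x q → q = P x)
    {x₀ : E} (hx₀ : x₀ ∈ V) :
    ∃ ε > 0, IsNearest S (x₀ + (ε : ℝ) • (x₀ - P x₀)) (P x₀) := by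
  by_cases hne : x₀ = P x₀
  · refine ⟨1, one_pos, ?_⟩
    have : x₀ + (1 : ℝ) • (x₀ - P x₀) = x₀ := by rw [one_smul, sub_eq_zero.2 hne, add_zero]
    rw [this]
    exact hP x₀ hx₀
  have hd0 : 0 < ‖x₀ - P x₀‖ := norm_pos_iff.2 (sub_ne_zero.2 hne)
  have hinf0 := (hP x₀ hx₀).infDist_eq
  obtain ⟨δ₀, hδ₀, hball₀⟩ := Metric.nhds_basis_closedBall.mem_iff.1 (hV.mem_nhds hx₀)
  -- The bound `δ < ‖x₀ - P x₀‖` keeps the distance to `S` positive throughout the ball.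
  obtain ⟨δ, hδ, hδδ₀, hδd⟩ : ∃ δ > 0, δ ≤ δ₀ ∧ δ < ‖x₀ - P x₀‖ :=
    ⟨min δ₀ (‖x₀ - P x₀‖ / 2), lt_min hδ₀ (half_pos hd0), min_le_left _ _,
      (min_le_right _ _).trans_lt (half_lt_self hd0)⟩
  have hball : closedBall x₀ δ ⊆ V := (closedBall_subset_closedBall hδδ₀).trans hball₀
  have hcpt : IsCompact (closedBall x₀ δ) := isCompact_closedBall _ _
  have hnonempty : (closedBall x₀ δ).Nonempty := ⟨x₀, mem_closedBall_self hδ.le⟩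
  have hcd : Continuous fun x => infDist x S := continuous_infDist_pt S
  -- A maximum of `infDist x S - μ * ‖x - x₀‖` over the ball lies on the boundary sphere: at an
  -- interior point, moving away from `P x` raises the first term at a rate above `μ`, while `‖x -
  -- x₀‖` grows at rate at most one.
  have hμ : ∀ μ : ℝ, 0 ≤ μ → μ < 1 → ∃ x ∈ closedBall x₀ δ, infDist x₀ S + μ * δ ≤ infDist x S := by
    intro μ hμ0 hμ1
    obtain ⟨x, hx, hmax⟩ := hcpt.exists_isMaxOn hnonempty
      (f := fun x => infDist x S - μ * ‖x - x₀‖) (by fun_prop)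
    refine ⟨x, hx, ?_⟩
    have hx0 := hmax (mem_closedBall_self hδ.le)
    simp only [Set.mem_ofPred_eq, sub_self, norm_zero, mul_zero, sub_zero] at hx0
    rw [mem_closedBall, dist_eq_norm] at hx
    rcases hx.eq_or_lt with h | h
    · rw [h] at hx0
      linarith
    exfalso
    have hxV : x ∈ V := hball (by rw [mem_closedBall, dist_eq_norm]; exact hx)
    have hxne : x ≠ P x := by
      intro he
      have h1 := (hP x hxV).infDist_eq
      rw [sub_eq_zero.2 he, norm_zero] at h1
      have : infDist x₀ S ≤ infDist x S + dist x₀ x := infDist_le_infDist_add_dist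
      rw [dist_comm, dist_eq_norm, h1, hinf0] at this
      linarith
    have hev := eventually_infDist_gt hV hP hxV (continuousAt_of_unique hV hP huniq hxV) hxne hμ1
    have hcurve : Tendsto (fun s : ℝ => x + s • (x - P x)) (𝓝[>] 0) (𝓝 x) := by
      have : Continuous fun s : ℝ => x + s • (x - P x) := by fun_prop
      have h0 := this.tendsto 0
      simp only [zero_smul, add_zero] at h0
      exact h0.mono_left nhdsWithin_le_nhds
    have hin : x ∈ ball x₀ δ := by rw [mem_ball, dist_eq_norm]; exact h
    obtain ⟨s, hs1, hs2, hs0⟩ := (hev.and ((hcurve.eventually (isOpen_ball.mem_nhds hin)).and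
      self_mem_nhdsWithin)).exists
    have hs0 : (0 : ℝ) < s := hs0
    have h3 : infDist (x + s • (x - P x)) S - μ * ‖x + s • (x - P x) - x₀‖ ≤
      infDist x S - μ * ‖x - x₀‖ := hmax (ball_subset_closedBall hs2)
    have h4 : ‖x + s • (x - P x) - x₀‖ ≤ ‖x - x₀‖ + s * ‖x - P x‖ := by
      rw [add_sub_right_comm]
      refine (norm_add_le _ _).trans_eq ?_
      rw [norm_smul, Real.norm_of_nonneg hs0.le]
    have := mul_le_mul_of_nonneg_left h4 hμ0
    linarith
  obtain ⟨x₁, hx₁, hmax⟩ := hcpt.exists_isMaxOn hnonempty hcd.continuousOn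
  -- Let `μ → 1`; compactness allows one point `x₁` to serve for all `μ`.
  have hge : infDist x₀ S + δ ≤ infDist x₁ S := by
    have hlim : Tendsto (fun μ : ℝ => infDist x₀ S + μ * δ) (𝓝[<] 1)
        (𝓝 (infDist x₀ S + 1 * δ)) := by
      have : Continuous fun μ : ℝ => infDist x₀ S + μ * δ := by fun_prop
      exact (this.tendsto 1).mono_left nhdsWithin_le_nhds
    rw [one_mul] at hlim
    refine le_of_tendsto hlim ?_
    filter_upwards [mem_nhdsWithin_of_mem_nhds (Ioi_mem_nhds (zero_lt_one' ℝ)),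
      self_mem_nhdsWithin] with μ h0 h1
    obtain ⟨x, hx, hxd⟩ := hμ μ (le_of_lt h0) h1
    exact hxd.trans (hmax hx)
  rw [mem_closedBall, dist_eq_norm] at hx₁
  have hsplit : x₁ - P x₀ = (x₁ - x₀) + (x₀ - P x₀) := by abel
  have htri : ‖x₁ - P x₀‖ ≤ ‖x₁ - x₀‖ + ‖x₀ - P x₀‖ := by
    rw [hsplit]; exact norm_add_le _ _
  have hle : infDist x₁ S ≤ ‖x₁ - P x₀‖ :=
    (infDist_le_dist_of_mem (hP x₀ hx₀).1).trans_eq (dist_eq_norm _ _)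
  have hδeq : ‖x₁ - x₀‖ = δ := by linarith
  -- The triangle inequality from `P x₀` through `x₀` to `x₁` is an equality, so strict convexity of
  -- the norm puts `x₁` on the ray from `P x₀` through `x₀`.
  have hray : SameRay ℝ (x₁ - x₀) (x₀ - P x₀) := by
    rw [sameRay_iff_norm_add, ← hsplit]
    linarith
  have hsmul := sameRay_iff_norm_smul_eq.1 hray
  rw [hδeq] at hsmul
  refine ⟨δ / ‖x₀ - P x₀‖, div_pos hδ hd0, ?_⟩
  have hx₁eq : x₀ + (δ / ‖x₀ - P x₀‖) • (x₀ - P x₀) = x₁ := by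
    rw [div_eq_inv_mul, mul_smul, hsmul, smul_smul, inv_mul_cancel₀ hd0.ne', one_smul]
    abel
  rw [hx₁eq]
  exact isNearest_of_infDist_eq (hP x₀ hx₀).1 (by linarith)

/-! ### First and second order conditions, and regularity of the squared distance -/

/-- The gradient of the squared distance at `x` is `2 (x - P x)`. -/
theorem hasFDerivAt_infDist_sq {S V : Set E} (hV : IsOpen V) {P : E → E}
    (hP : ∀ x ∈ V, IsNearest S x (P x)) {x : E} (hx : x ∈ V) (hc : ContinuousAt P x) :
    HasFDerivAt (fun y => infDist y S ^ 2) ((2 : ℝ) • innerSL ℝ (x - P x)) x := by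
  rw [hasFDerivAt_iff_isLittleO, Asymptotics.isLittleO_iff]
  intro c hc0
  -- Using `P x` as a competitor at `y` and `P y` as a competitor at `x` bounds the remainder by `‖y
  -- - x‖ * (‖y - x‖ + 2 * ‖P y - P x‖)`.
  have hlim : Tendsto (fun y => ‖y - x‖ + 2 * ‖P y - P x‖) (𝓝 x) (𝓝 0) := by
    have h1 : Tendsto (fun y : E => y - x) (𝓝 x) (𝓝 (x - x)) := tendsto_id.sub_const x
    have h2 : Tendsto (fun y : E => P y - P x) (𝓝 x) (𝓝 (P x - P x)) := hc.tendsto.sub_const _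
    simpa using h1.norm.add (h2.norm.const_mul 2)
  filter_upwards [hlim.eventually (gt_mem_nhds hc0), hV.mem_nhds hx] with y hy hyV
  have hRx := (hP x hx).infDist_eq
  have hRy := (hP y hyV).infDist_eq
  have hup : ‖y - P y‖ ^ 2 ≤ ‖y - P x‖ ^ 2 := by
    gcongr
    exact (hP y hyV).2 _ (hP x hx).1
  have hlo : ‖x - P x‖ ^ 2 ≤ ‖x - P y‖ ^ 2 := by
    gcongr
    exact (hP x hx).2 _ (hP y hyV).1
  have e1 : ‖y - P x‖ ^ 2 = ‖y - x‖ ^ 2 + 2 * inner ℝ (y - x) (x - P x) + ‖x - P x‖ ^ 2 := by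
    rw [← norm_add_sq_real]; congr 2; abel
  have e2 : ‖y - P y‖ ^ 2 = ‖y - x‖ ^ 2 + 2 * inner ℝ (y - x) (x - P y) + ‖x - P y‖ ^ 2 := by
    rw [← norm_add_sq_real]; congr 2; abel
  have e3 : inner ℝ (y - x) (x - P y) =
      inner ℝ (y - x) (x - P x) - inner ℝ (y - x) (P y - P x) := by
    rw [← inner_sub_right]; congr 1; abel
  have h4 : inner ℝ (y - x) (P y - P x) ≤ ‖y - x‖ * ‖P y - P x‖ := real_inner_le_norm _ _
  simp only [smul_apply, innerSL_apply_apply, smul_eq_mul]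
  rw [hRx, hRy, real_inner_comm (y - x) (x - P x), Real.norm_eq_abs]
  have h5 : (‖y - x‖ + 2 * ‖P y - P x‖) * ‖y - x‖ ≤ c * ‖y - x‖ := by gcongr
  have h6 := norm_nonneg (y - x)
  have h7 := norm_nonneg (P y - P x)
  rw [abs_le]
  constructor <;> nlinarith [mul_nonneg h6 h7]

/-- The second derivative is nonnegative at a local minimum. -/
theorem second_deriv_nonneg_of_isLocalMin {f f' : ℝ → ℝ} {a f'' : ℝ} (hmin : IsLocalMin f a)
    (hf : ∀ᶠ t in 𝓝 a, HasDerivAt f (f' t) t) (hf' : HasDerivAt f' f'' a) : 0 ≤ f'' := by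
  have hd : deriv f =ᶠ[𝓝 a] f' := hf.mono fun t ht => ht.deriv
  have hdd : deriv (deriv f) a = f'' := by rw [hd.deriv_eq, hf'.deriv]
  by_contra! hneg
  -- A negative second derivative would make `a` a local maximum as well; `f` would be locally
  -- constant and the second derivative zero.
  have hmax : IsLocalMax f a := isLocalMax_of_deriv_deriv_neg (by rwa [hdd]) hmin.deriv_eq_zero
    hf.self_of_nhds.continuousAt
  have hconst : f =ᶠ[𝓝 a] fun _ => f a := by
    filter_upwards [hmin, hmax] with t h1 h2 using le_antisymm h2 h1
  have h0 : deriv f =ᶠ[𝓝 a] fun _ => 0 := by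
    refine hconst.deriv.trans (Eventually.of_forall fun t => ?_)
    simp
  rw [h0.deriv_eq, deriv_const] at hdd
  exact hneg.ne hdd.symm

variable {G : Type*} [NormedAddCommGroup G] [NormedSpace ℝ G]

/-- `S` is a `C²` submanifold near `p`, parametrized by an immersion `q` of the normed space `G`
which admits a differentiable left inverse `τ`. -/
structure IsC2ParamAt (S : Set E) (p : E) (q : G → E) (τ : E → G) (θ : G) : Prop where
  contDiffAt : ContDiffAt ℝ 2 q θ
  map_base : q θ = p
  inv_base : τ p = θ
  mem : ∀ᶠ ϑ in 𝓝 θ, q ϑ ∈ S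
  differentiableAt : DifferentiableAt ℝ τ p
  leftInv : ∀ᶠ ϑ in 𝓝 θ, τ (q ϑ) = ϑ
  rightInv : ∀ᶠ y in 𝓝 p, y ∈ S → q (τ y) = y

/-- Differentiating `τ ∘ q = id` gives a left inverse of the derivative of `q`. -/
theorem IsC2ParamAt.fderiv_ne_zero {S : Set E} {p : E} {q : G → E} {τ : E → G} {θ : G}
    (h : IsC2ParamAt S p q τ θ) {ξ : G} (hξ : ξ ≠ 0) : fderiv ℝ q θ ξ ≠ 0 := by
  have hq : HasFDerivAt q (fderiv ℝ q θ) θ :=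
    (h.contDiffAt.differentiableAt two_ne_zero).hasFDerivAt
  have hτ : HasFDerivAt τ (fderiv ℝ τ p) (q θ) := by
    rw [h.map_base]; exact h.differentiableAt.hasFDerivAt
  have hcomp := hτ.comp θ hq
  have hid : HasFDerivAt (τ ∘ q) (ContinuousLinearMap.id ℝ G) θ :=
    (hasFDerivAt_id θ).congr_of_eventuallyEq h.leftInv
  have := hcomp.unique hid
  intro h0
  have h1 := congrArg (fun L => L ξ) this
  simp only [ContinuousLinearMap.comp_apply, h0, map_zero, ContinuousLinearMap.id_apply] at h1
  exact hξ h1.symm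

/-- The derivative in `ϑ` of `‖x - q ϑ‖ ^ 2 / 2` is `-criticalMap q (x, ϑ)`. -/
def criticalMap (q : G → E) (v : E × G) : G →L[ℝ] ℝ :=
  (innerSL ℝ (v.1 - q v.2)).comp (fderiv ℝ q v.2)

theorem criticalMap_apply (q : G → E) (x : E) (θ ξ : G) :
    criticalMap q (x, θ) ξ = inner ℝ (x - q θ) (fderiv ℝ q θ ξ) := rfl

theorem contDiffAt_criticalMap {q : G → E} {x : E} {θ : G} (hq : ContDiffAt ℝ 2 q θ) :
    ContDiffAt ℝ 1 (criticalMap q) (x, θ) := by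
  have h2 : ContDiffAt ℝ 1 (fun v : E × G => fderiv ℝ q v.2) (x, θ) :=
    ContDiffAt.comp (x, θ) (hq.fderiv_right (m := 1) (by norm_num)) contDiffAt_snd
  have h3 : ContDiffAt ℝ 1 (fun v : E × G => q v.2) (x, θ) :=
    ContDiffAt.comp (x, θ) (hq.of_le one_le_two) contDiffAt_snd
  have h4 : ContDiffAt ℝ 1 (fun v : E × G => innerSL ℝ (v.1 - q v.2)) (x, θ) :=
    (innerSL ℝ).contDiff.contDiffAt.comp (x, θ) (contDiffAt_fst.sub h3)
  exact h4.clm_comp h2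

/-- Up to the factor `-2`, this is the Hessian in `ϑ` of `‖x - q ϑ‖ ^ 2`. Its invertibility is what
the implicit function theorem requires. -/
theorem fderiv_criticalMap_apply {q : G → E} {x : E} {θ : G} (hq : ContDiffAt ℝ 2 q θ) (η ξ : G) :
    fderiv ℝ (criticalMap q) (x, θ) (0, η) ξ =
      inner ℝ (x - q θ) (fderiv ℝ (fderiv ℝ q) θ η ξ) -
        inner ℝ (fderiv ℝ q θ η) (fderiv ℝ q θ ξ) := by
  have hΨ : HasFDerivAt (criticalMap q) (fderiv ℝ (criticalMap q) (x, θ)) (x, θ) :=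
    ((contDiffAt_criticalMap hq).differentiableAt one_ne_zero).hasFDerivAt
  have hline : HasDerivAt (fun t : ℝ => ((x, θ + t • η) : E × G)) (0, η) 0 := by
    refine (hasDerivAt_const (0 : ℝ) x).prodMk ?_
    simpa using ((hasDerivAt_id (0 : ℝ)).smul_const η).const_add θ
  have hline' : HasDerivAt (fun t : ℝ => θ + t • η) η 0 := by
    simpa using ((hasDerivAt_id (0 : ℝ)).smul_const η).const_add θ
  have h1 : HasDerivAt (fun t : ℝ => criticalMap q (x, θ + t • η))
      (fderiv ℝ (criticalMap q) (x, θ) (0, η)) 0 := by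
    have hΨ' : HasFDerivAt (criticalMap q) (fderiv ℝ (criticalMap q) (x, θ))
        (x, θ + (0 : ℝ) • η) := by simpa using hΨ
    exact hΨ'.comp_hasDerivAt 0 hline
  have h2 : HasDerivAt (fun t : ℝ => criticalMap q (x, θ + t • η) ξ)
      (fderiv ℝ (criticalMap q) (x, θ) (0, η) ξ) 0 := by
    simpa using h1.clm_apply (hasDerivAt_const (0 : ℝ) ξ)
  have hq1 : HasFDerivAt q (fderiv ℝ q θ) (θ + (0 : ℝ) • η) := by
    simpa using (hq.differentiableAt two_ne_zero).hasFDerivAt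
  have hq2 : HasFDerivAt (fderiv ℝ q) (fderiv ℝ (fderiv ℝ q) θ) (θ + (0 : ℝ) • η) := by
    simpa using ((hq.fderiv_right (m := 1) (by norm_num)).differentiableAt one_ne_zero).hasFDerivAt
  have h3 : HasDerivAt (fun t : ℝ => x - q (θ + t • η)) (-fderiv ℝ q θ η) 0 :=
    (hq1.comp_hasDerivAt 0 hline').const_sub x
  have h4 : HasDerivAt (fun t : ℝ => fderiv ℝ q (θ + t • η) ξ)
      (fderiv ℝ (fderiv ℝ q) θ η ξ) 0 := by
    have h : HasDerivAt (fun t : ℝ => fderiv ℝ q (θ + t • η)) (fderiv ℝ (fderiv ℝ q) θ η) 0 :=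
      hq2.comp_hasDerivAt 0 hline'
    simpa using h.clm_apply (hasDerivAt_const (0 : ℝ) ξ)
  have h5 := h3.inner ℝ h4
  simp only [criticalMap_apply] at h2
  rw [h2.unique h5]
  simp only [zero_smul, add_zero, inner_neg_left]
  ring

/-- First order condition at a nearest point. -/
theorem criticalMap_eq_zero {S : Set E} {q : G → E} {x : E} {θ : G}
    (hq : DifferentiableAt ℝ q θ) (hmem : ∀ᶠ ϑ in 𝓝 θ, q ϑ ∈ S) (hn : IsNearest S x (q θ)) :
    criticalMap q (x, θ) = 0 := by
  have hmin : IsLocalMin (fun ϑ => ‖x - q ϑ‖ ^ 2) θ := by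
    filter_upwards [hmem] with ϑ hϑ
    have := hn.2 _ hϑ
    gcongr
  have hd : HasFDerivAt (fun ϑ => ‖x - q ϑ‖ ^ 2)
      (2 • (innerSL ℝ (x - q θ)).comp (-fderiv ℝ q θ)) θ :=
    (hq.hasFDerivAt.const_sub x).norm_sq
  have h0 := hmin.hasFDerivAt_eq_zero hd
  ext ξ
  have h1 := congrArg (fun L => L ξ) h0
  simp only [smul_apply, ContinuousLinearMap.comp_apply, neg_apply, map_neg, smul_neg,
    innerSL_apply_apply, zero_apply, neg_eq_zero, nsmul_eq_mul, mul_eq_zero] at h1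
  rw [criticalMap_apply]
  simpa using h1

/-- Second order condition at a nearest point. -/
theorem second_order_condition {S : Set E} {q : G → E} {x : E} {θ : G}
    (hq : ContDiffAt ℝ 2 q θ) (hmem : ∀ᶠ ϑ in 𝓝 θ, q ϑ ∈ S) (hn : IsNearest S x (q θ)) (ξ : G) :
    inner ℝ (x - q θ) (fderiv ℝ (fderiv ℝ q) θ ξ ξ) ≤
      inner ℝ (fderiv ℝ q θ ξ) (fderiv ℝ q θ ξ) := by
  have hline : Tendsto (fun t : ℝ => θ + t • ξ) (𝓝 0) (𝓝 θ) := by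
    have : Continuous fun t : ℝ => θ + t • ξ := by fun_prop
    simpa using this.tendsto 0
  have hline' : ∀ t : ℝ, HasDerivAt (fun t : ℝ => θ + t • ξ) ξ t := fun t => by
    simpa using ((hasDerivAt_id t).smul_const ξ).const_add θ
  have hmin : IsLocalMin (fun t : ℝ => ‖x - q (θ + t • ξ)‖ ^ 2) 0 := by
    filter_upwards [hline.eventually hmem] with t ht
    have := hn.2 _ ht
    simp only [zero_smul, add_zero]
    gcongr
  have hev : ∀ᶠ ϑ in 𝓝 θ, ContDiffAt ℝ 2 q ϑ := hq.eventually (by simp)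
  have hd : ∀ᶠ t : ℝ in 𝓝 0, HasDerivAt (fun t : ℝ => ‖x - q (θ + t • ξ)‖ ^ 2)
      (-2 * criticalMap q (x, θ + t • ξ) ξ) t := by
    filter_upwards [hline.eventually hev] with t ht
    have h1 : HasDerivAt (fun t : ℝ => x - q (θ + t • ξ)) (-fderiv ℝ q (θ + t • ξ) ξ) t :=
      ((ht.differentiableAt two_ne_zero).hasFDerivAt.comp_hasDerivAt t (hline' t)).const_sub x
    convert h1.norm_sq using 1
    rw [criticalMap_apply, inner_neg_right]
    ring
  have hdd : HasDerivAt (fun t : ℝ => -2 * criticalMap q (x, θ + t • ξ) ξ)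
      (-2 * fderiv ℝ (criticalMap q) (x, θ) (0, ξ) ξ) 0 := by
    have hΨ : HasFDerivAt (criticalMap q) (fderiv ℝ (criticalMap q) (x, θ))
        (x, θ + (0 : ℝ) • ξ) := by
      simpa using ((contDiffAt_criticalMap hq).differentiableAt one_ne_zero).hasFDerivAt
    have h1 := hΨ.comp_hasDerivAt 0 ((hasDerivAt_const (0 : ℝ) x).prodMk (hline' 0))
    have h2 := h1.clm_apply (hasDerivAt_const (0 : ℝ) ξ)
    simpa using h2.const_mul (-2)
  have h := second_deriv_nonneg_of_isLocalMin hmin hd hdd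
  rw [fderiv_criticalMap_apply hq] at h
  linarith

theorem isInvertible_of_injective_dual [FiniteDimensional ℝ G] {L : G →L[ℝ] (G →L[ℝ] ℝ)}
    (hL : Function.Injective L) : L.IsInvertible := by
  have hrank : Module.finrank ℝ G = Module.finrank ℝ (G →L[ℝ] ℝ) := by
    rw [← (LinearMap.toContinuousLinearMap (𝕜 := ℝ) (E := G) (F' := ℝ)).finrank_eq]
    exact (Subspace.dual_finrank_eq (K := ℝ) (V := G)).symm
  let e := (LinearEquiv.ofInjectiveOfFinrankEq L.toLinearMap hL hrank).toContinuousLinearEquiv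
  exact ⟨e, by ext; rfl⟩

/-- The squared distance to a set which is a `C²` submanifold near the nearest point of `x₀` is of
class `C²` at `x₀`, if the points near `x₀` have unique nearest points. -/
theorem contDiffAt_infDist_sq [FiniteDimensional ℝ E] [FiniteDimensional ℝ G]
    {S V : Set E} (hV : IsOpen V) {P : E → E}
    (hP : ∀ x ∈ V, IsNearest S x (P x)) (huniq : ∀ x ∈ V, ∀ q, IsNearest S x q → q = P x)
    {x₀ : E} (hx₀ : x₀ ∈ V) {q : G → E} {τ : E → G} {θ : G}
    (hS : IsC2ParamAt S (P x₀) q τ θ) :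
    ContDiffAt ℝ 2 (fun y => infDist y S ^ 2) x₀ := by
  have hPc : ∀ x ∈ V, ContinuousAt P x := fun x hx => continuousAt_of_unique hV hP huniq hx
  have hq := hS.contDiffAt
  -- A kernel vector `ξ` would give `⟨x₀ - q θ, q''(ξ, ξ)⟩ = ‖q' ξ‖ ^ 2 > 0`. The second order
  -- condition at the prolonged point has the left side multiplied by `1 + ε`, which is a
  -- contradiction.
  have hinj : Function.Injective
      (fderiv ℝ (criticalMap q) (x₀, θ) ∘L ContinuousLinearMap.inr ℝ E G) := by
    rw [injective_iff_map_eq_zero]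
    intro ξ hξ
    by_contra hne
    have h0 : fderiv ℝ (criticalMap q) (x₀, θ) (0, ξ) ξ = 0 := by
      have := congrArg (fun L => L ξ) hξ
      simpa using this
    rw [fderiv_criticalMap_apply hq] at h0
    have hpos : 0 < inner ℝ (fderiv ℝ q θ ξ) (fderiv ℝ q θ ξ) := by
      rw [real_inner_self_eq_norm_sq]
      have := norm_pos_iff.2 (hS.fderiv_ne_zero hne)
      positivity
    obtain ⟨ε, hε, hn⟩ := exists_isNearest_prolongation hV hP huniq hx₀
    rw [← hS.map_base] at hn
    have h2 := second_order_condition hq hS.mem hn ξ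
    have e : x₀ + ε • (x₀ - q θ) - q θ = (1 + ε) • (x₀ - q θ) := by
      rw [add_smul, one_smul]; abel
    rw [e, inner_smul_left] at h2
    simp only [conj_trivial] at h2
    nlinarith
  have hinv := isInvertible_of_injective_dual hinj
  have hΨ : ContDiffAt ℝ 1 (criticalMap q) (x₀, θ) := contDiffAt_criticalMap hq
  have hΨ0 : criticalMap q (x₀, θ) = 0 :=
    criticalMap_eq_zero (hq.differentiableAt two_ne_zero) hS.mem
      (by rw [hS.map_base]; exact hP x₀ hx₀)
  have hτP : Tendsto (fun x => τ (P x)) (𝓝 x₀) (𝓝 θ) := by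
    have h1 : Tendsto τ (𝓝 (P x₀)) (𝓝 θ) := by
      have := hS.differentiableAt.continuousAt.tendsto
      rwa [hS.inv_base] at this
    exact h1.comp (hPc x₀ hx₀)
  have hev : ∀ᶠ ϑ in 𝓝 θ, ContDiffAt ℝ 2 q ϑ := hq.eventually (by simp)
  have himpl := hΨ.eventually_apply_eq_iff_implicitFunction one_ne_zero hinv
  -- Continuity of `P` keeps `(x, τ (P x))` near `(x₀, θ)`, where the implicit function gives the
  -- only critical parameter for `x`.
  have hPeq : P =ᶠ[𝓝 x₀] fun x => q (hΨ.implicitFunction one_ne_zero hinv x) := by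
    have hpair : Tendsto (fun x => (x, τ (P x))) (𝓝 x₀) (𝓝 (x₀, θ)) :=
      tendsto_id.prodMk_nhds hτP
    filter_upwards [hpair.eventually himpl, hV.mem_nhds hx₀,
      (hPc x₀ hx₀).tendsto.eventually hS.rightInv, hτP.eventually hev,
      hτP.eventually hS.mem.eventually_nhds] with x h1 hxV hr hd hm
    have hqx := hr (hP x hxV).1
    have hcrit : criticalMap q (x, τ (P x)) = 0 :=
      criticalMap_eq_zero (hd.differentiableAt two_ne_zero) hm (by rw [hqx]; exact hP x hxV)
    have h2 := h1.1 (by rw [hcrit, hΨ0])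
    rw [h2, hqx]
  have hP1 : ContDiffAt ℝ 1 P x₀ := by
    refine ContDiffAt.congr_of_eventuallyEq ?_ hPeq
    have h1 := hΨ.contDiffAt_implicitFunction one_ne_zero hinv
    have h0 := hΨ.implicitFunction_apply_self one_ne_zero hinv
    refine ContDiffAt.comp x₀ ?_ h1
    rw [h0]
    exact hq.of_le one_le_two
  have h2 : ((1 : ℕ) : WithTop ℕ∞) + 1 = 2 := by norm_num
  rw [← h2]
  refine contDiffAt_succ_iff_hasFDerivAt.2 ⟨fun x => (2 : ℝ) • innerSL ℝ (x - P x),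
    ⟨V, hV.mem_nhds hx₀, fun x hx => hasFDerivAt_infDist_sq hV hP hx (hPc x hx)⟩, ?_⟩
  have h3 : ContDiffAt ℝ 1 (fun x => innerSL ℝ (x - P x)) x₀ :=
    (innerSL ℝ).contDiff.contDiffAt.comp x₀ (contDiffAt_id.sub hP1)
  exact h3.const_smul (2 : ℝ)

end NearestPoint

namespace ProjectiveSelfConvexity

open NearestPoint

/-! ### Curves on the sphere: the geodesic equation and the differential inequality -/

section Curves

variable {E F : Type*} [NormedAddCommGroup E] [InnerProductSpace ℝ E]
  [NormedAddCommGroup F] [NormedSpace ℝ F]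

theorem hasDerivAt_deriv_of_contDiffAt {X : ℝ → E} {t : ℝ} (hX : ContDiffAt ℝ 2 X t) :
    HasDerivAt (deriv X) (deriv (deriv X) t) t := by
  have h : DifferentiableAt ℝ (deriv X) t := by
    have := (hX.fderiv_right (m := 1) (by norm_num)).differentiableAt one_ne_zero
    exact this.clm_apply (differentiableAt_const 1)
  exact h.hasDerivAt

theorem eventually_hasDerivAt_of_contDiffAt {X : ℝ → E} {t : ℝ} (hX : ContDiffAt ℝ 2 X t) :
    ∀ᶠ τ in 𝓝 t, HasDerivAt X (deriv X τ) τ :=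
  (hX.eventually (by simp)).mono fun _ h => (h.differentiableAt two_ne_zero).hasDerivAt

theorem deriv_comp_eq {s : F → E} {c : ℝ → F} {t : ℝ} (hs : DifferentiableAt ℝ s (c t))
    (hc : DifferentiableAt ℝ c t) : deriv (fun τ => s (c τ)) t = fderiv ℝ s (c t) (deriv c t) :=
  (hs.hasFDerivAt.comp_hasDerivAt t hc.hasDerivAt).deriv

/-- The geodesic equation of `a` times the metric induced by `s`, for the image of the curve
under `s`. -/
theorem geodesicEquation_image {s : F → E} {a : F → ℝ} {c : ℝ → F} {t : ℝ}
    (hs : ContDiffAt ℝ 2 s (c t)) (ha : DifferentiableAt ℝ a (c t))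
    (hc : ContDiffAt ℝ 2 c t) {c' : F} (hc' : deriv c t = c')
    (hgeo : SatisfiesGeodesicEquationAt
      (fun v u w => a v * inner ℝ (fderiv ℝ s v u) (fderiv ℝ s v w)) c t) (w : F) :
    a (c t) * inner ℝ (deriv (deriv fun τ => s (c τ)) t) (fderiv ℝ s (c t) w) +
      fderiv ℝ a (c t) c' * inner ℝ (deriv (fun τ => s (c τ)) t) (fderiv ℝ s (c t) w) -
      fderiv ℝ a (c t) w * ‖deriv (fun τ => s (c τ)) t‖ ^ 2 / 2 = 0 := by
  have hD : DifferentiableAt ℝ (fderiv ℝ s) (c t) :=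
    (hs.fderiv_right (m := 1) (by norm_num)).differentiableAt one_ne_zero
  have hDu : ∀ u, HasFDerivAt (fun v => fderiv ℝ s v u)
      ((fderiv ℝ (fderiv ℝ s) (c t)).flip u) (c t) := fun u => by
    simpa using hD.hasFDerivAt.clm_apply (hasFDerivAt_const u (c t))
  have hg : ∀ u w η, fderiv ℝ (fun v => a v * inner ℝ (fderiv ℝ s v u) (fderiv ℝ s v w)) (c t) η =
      a (c t) * (inner ℝ (fderiv ℝ s (c t) u) (fderiv ℝ (fderiv ℝ s) (c t) η w) +
        inner ℝ (fderiv ℝ (fderiv ℝ s) (c t) η u) (fderiv ℝ s (c t) w)) +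
      inner ℝ (fderiv ℝ s (c t) u) (fderiv ℝ s (c t) w) * fderiv ℝ a (c t) η := by
    intro u w η
    rw [fderiv_fun_mul ha ((hDu u).differentiableAt.inner ℝ (hDu w).differentiableAt)]
    simp only [add_apply, smul_apply, smul_eq_mul]
    rw [fderiv_inner_apply ℝ (hDu u).differentiableAt (hDu w).differentiableAt, (hDu u).fderiv,
      (hDu w).fderiv]
    simp only [ContinuousLinearMap.flip_apply]
  have hsymm : ∀ u w, fderiv ℝ (fderiv ℝ s) (c t) u w = fderiv ℝ (fderiv ℝ s) (c t) w u :=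
    fun u w => (hs.isSymmSndFDerivAt (by simp)) u w
  have hX' : deriv (fun τ => s (c τ)) =ᶠ[𝓝 t] fun τ => fderiv ℝ s (c τ) (deriv c τ) := by
    have h1 : ∀ᶠ τ in 𝓝 t, ContDiffAt ℝ 2 s (c τ) :=
      hc.continuousAt.eventually (hs.eventually (by simp))
    filter_upwards [h1, hc.eventually (by simp)] with τ h2 h3
    exact deriv_comp_eq (h2.differentiableAt two_ne_zero) (h3.differentiableAt two_ne_zero)
  have hX'' : deriv (deriv fun τ => s (c τ)) t =
      fderiv ℝ (fderiv ℝ s) (c t) c' c' + fderiv ℝ s (c t) (deriv (deriv c) t) := by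
    rw [hX'.deriv_eq]
    have hcd : HasDerivAt c (deriv c t) t := (hc.differentiableAt two_ne_zero).hasDerivAt
    have hcdd : HasDerivAt (deriv c) (deriv (deriv c) t) t := by
      have := (hc.fderiv_right (m := 1) (by norm_num)).differentiableAt one_ne_zero
      exact (this.clm_apply (differentiableAt_const 1)).hasDerivAt
    have h1 : HasDerivAt (fun τ => fderiv ℝ s (c τ)) (fderiv ℝ (fderiv ℝ s) (c t) (deriv c t)) t :=
      hD.hasFDerivAt.comp_hasDerivAt t hcd
    rw [(h1.clm_apply hcdd).deriv, hc']
  have hX't : deriv (fun τ => s (c τ)) t = fderiv ℝ s (c t) (deriv c t) := hX'.self_of_nhds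
  have h := hgeo w
  simp only [christoffel, hg] at h
  rw [hc'] at h hX't
  rw [hX'', hX't, inner_add_left, ← real_inner_self_eq_norm_sq]
  -- By symmetry of the second derivative of `s`, the Christoffel terms pairing `fderiv ℝ s (c t)
  -- c'` with the mixed second derivative cancel, leaving the acceleration of the image curve.
  rw [hsymm c' w, real_inner_comm (fderiv ℝ s (c t) c') (fderiv ℝ (fderiv ℝ s) (c t) w c')] at h
  linarith

/-- A differential inequality for the squared distance `r` from a curve on the unit sphere, which
satisfies the geodesic equation in the direction `X - p - r X`. -/
theorem mul_deriv_deriv_le_sq {X : ℝ → E} {r : ℝ → ℝ} {t : ℝ} {p : E}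
    (hX : ContDiffAt ℝ 2 X t) (hr : ContDiffAt ℝ 2 r t) (hnorm : ∀ᶠ τ in 𝓝 t, ‖X τ‖ = 1)
    (hle : ∀ᶠ τ in 𝓝 t, r τ ≤ ‖X τ - p‖ ^ 2) (heq : r t = ‖X t - p‖ ^ 2)
    (hp : inner ℝ (X t - p) p = 0) (hpos : 0 < r t)
    (hgeo : r t * inner ℝ (deriv (deriv X) t) (X t - p - r t • X t) =
      deriv r t * inner ℝ (deriv X t) (X t - p - r t • X t) -
        ‖deriv X t‖ ^ 2 * inner ℝ (X t - p) (X t - p - r t • X t)) :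
    r t * deriv (deriv r) t ≤ deriv r t ^ 2 := by
  have hX1 := eventually_hasDerivAt_of_contDiffAt hX
  have hX2 := hasDerivAt_deriv_of_contDiffAt hX
  have hr1 := eventually_hasDerivAt_of_contDiffAt hr
  have hr2 := hasDerivAt_deriv_of_contDiffAt hr
  have hX1t := hX1.self_of_nhds
  have hr1t := hr1.self_of_nhds
  -- Only `X` moves: with `p` frozen, no derivative of the nearest point enters.
  have hmin : IsLocalMin (fun τ => ‖X τ - p‖ ^ 2 - r τ) t := by
    filter_upwards [hle] with τ hτ
    rw [heq]
    linarith
  have hd1 : ∀ᶠ τ in 𝓝 t, HasDerivAt (fun τ => ‖X τ - p‖ ^ 2 - r τ)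
      (2 * inner ℝ (X τ - p) (deriv X τ) - deriv r τ) τ := by
    filter_upwards [hX1, hr1] with τ h1 h2
    exact (h1.sub_const p).norm_sq.sub h2
  have hd2 : HasDerivAt (fun τ => 2 * inner ℝ (X τ - p) (deriv X τ) - deriv r τ)
      (2 * (inner ℝ (X t - p) (deriv (deriv X) t) + inner ℝ (deriv X t) (deriv X t)) -
        deriv (deriv r) t) t :=
    (((hX1t.sub_const p).inner ℝ hX2).const_mul 2).sub hr2
  have hfirst := hmin.hasDerivAt_eq_zero hd1.self_of_nhds
  have hsecond := second_deriv_nonneg_of_isLocalMin hmin hd1 hd2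
  have hort : (fun τ => inner ℝ (X τ) (deriv X τ)) =ᶠ[𝓝 t] fun _ => (0 : ℝ) := by
    filter_upwards [hX1, hnorm.eventually_nhds] with τ h1 h2
    have h3 : HasDerivAt (fun τ => ‖X τ‖ ^ 2) 0 τ := by
      refine (hasDerivAt_const τ (1 : ℝ)).congr_of_eventuallyEq ?_
      filter_upwards [h2] with σ hσ
      rw [hσ, one_pow]
    have := h1.norm_sq.unique h3
    linarith
  have hort' : inner ℝ (X t) (deriv (deriv X) t) + inner ℝ (deriv X t) (deriv X t) = 0 := by
    have h1 := hX1t.inner ℝ hX2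
    exact h1.unique ((hasDerivAt_const t (0 : ℝ)).congr_of_eventuallyEq hort)
  have hort0 : inner ℝ (X t) (deriv X t) = 0 := hort.self_of_nhds
  have hXX : inner ℝ (X t - p) (X t) = r t := by
    have : inner ℝ (X t - p) (X t) = inner ℝ (X t - p) (X t - p) + inner ℝ (X t - p) p := by
      rw [← inner_add_right, sub_add_cancel]
    rw [this, hp, heq, real_inner_self_eq_norm_sq, add_zero]
  rw [inner_sub_right _ (X t - p), inner_sub_right _ (X t - p), inner_sub_right _ (X t - p),
    inner_smul_right, inner_smul_right, inner_smul_right, hXX, real_inner_self_eq_norm_sq, ← heq,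
    real_inner_comm (X t) (deriv X t), real_inner_comm (X t) (deriv (deriv X) t),
    real_inner_comm (X t - p) (deriv X t), real_inner_comm (X t - p) (deriv (deriv X) t)] at hgeo
  rw [real_inner_self_eq_norm_sq] at hsecond hort'
  rw [hort0] at hgeo
  have e1 : inner ℝ (X t - p) (deriv X t) = deriv r t / 2 := by linarith
  have e2 : inner ℝ (X t) (deriv (deriv X) t) = -‖deriv X t‖ ^ 2 := by linarith
  -- The `r ^ 2 * ‖X'‖ ^ 2` terms cancel and `hgeo` becomes `2 r (⟨X - p, X''⟩ + ‖X'‖ ^ 2) = r' ^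
  -- 2`; it remains to multiply `hsecond` by `r`.
  rw [e1, e2] at hgeo
  nlinarith [mul_nonneg hpos.le hsecond]

/-- The second derivative of `-log r` is `(r' ^ 2 - r r'') / r ^ 2`. -/
theorem deriv_deriv_neg_log_nonneg {r : ℝ → ℝ} {t : ℝ} (hr : ContDiffAt ℝ 2 r t) (hpos : 0 < r t)
    (h : r t * deriv (deriv r) t ≤ deriv r t ^ 2) :
    0 ≤ deriv (deriv fun τ => -Real.log (r τ)) t := by
  have hr1 := eventually_hasDerivAt_of_contDiffAt hr
  have hr2 := hasDerivAt_deriv_of_contDiffAt hr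
  have h1 : (deriv fun τ => -Real.log (r τ)) =ᶠ[𝓝 t] fun τ => -(deriv r τ / r τ) := by
    filter_upwards [hr1, hr.continuousAt.eventually (lt_mem_nhds hpos)] with τ h1 h2
    exact (h1.log h2.ne').fun_neg.deriv
  rw [h1.deriv_eq, ((hr2.fun_div hr1.self_of_nhds hpos.ne').fun_neg).deriv]
  rw [neg_nonneg]
  refine div_nonpos_of_nonpos_of_nonneg ?_ (sq_nonneg _)
  nlinarith

end Curves

variable {j : ℕ}

/-! ### The cone over `N` and its nearest points -/

/-- The union of the lines belonging to `N`. -/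
def projCone (N : Set (Proj j)) : Set (EuclideanSpace ℝ (Fin j)) :=
  {c | ∃ y ∈ N, c ∈ y.submodule}

/-- The nonzero vectors spanning a line in `W`. -/
def vectorLift (W : Set (Proj j)) : Set (EuclideanSpace ℝ (Fin j)) :=
  {a | ∃ h : a ≠ 0, Projectivization.mk ℝ a h ∈ W}

theorem isOpen_vectorLift {W : Set (Proj j)} : IsOpen (vectorLift W) ↔ IsOpen W := by
  have himg : vectorLift W = Subtype.val ''
      ((Projectivization.mk' ℝ : {v : EuclideanSpace ℝ (Fin j) // v ≠ 0} → Proj j) ⁻¹' W) := by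
    ext a
    constructor
    · rintro ⟨h, hW⟩
      exact ⟨⟨a, h⟩, by simpa [Projectivization.mk'_eq_mk] using hW, rfl⟩
    · rintro ⟨⟨b, h⟩, hW, rfl⟩
      exact ⟨h, by simpa [Projectivization.mk'_eq_mk] using hW⟩
  have hemb : IsOpenEmbedding
      (Subtype.val : {v : EuclideanSpace ℝ (Fin j) // v ≠ 0} → EuclideanSpace ℝ (Fin j)) :=
    isOpen_ne.isOpenEmbedding_subtypeVal
  rw [himg, ← hemb.isOpen_iff_image_isOpen]
  exact isOpen_coinduced.symm

/-- Pythagoras: `‖a‖` times the sine of the angle to a line is the length of the component of `a`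
orthogonal to it. This translates `dP` into Euclidean distance. -/
theorem norm_mul_dP_mk {a : EuclideanSpace ℝ (Fin j)} (ha : a ≠ 0) (y : Proj j) :
    ‖a‖ * dP (Projectivization.mk ℝ a ha) y = ‖a - y.submodule.starProjection a‖ := by
  obtain ⟨u, hu⟩ := Projectivization.exists_smul_eq_mk_rep ℝ a ha
  have hb : 0 < ‖y.rep‖ := norm_pos_iff.2 y.rep_nonzero
  have ha' : 0 < ‖a‖ := norm_pos_iff.2 ha
  have hu0 : 0 < |(u : ℝ)| := abs_pos.2 u.ne_zero
  have ht : |inner ℝ (Projectivization.mk ℝ a ha).rep y.rep| /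
      (‖(Projectivization.mk ℝ a ha).rep‖ * ‖y.rep‖) = |inner ℝ a y.rep| / (‖a‖ * ‖y.rep‖) := by
    rw [← hu, Units.smul_def, inner_smul_left, norm_smul, Real.norm_eq_abs, abs_mul]
    simp only [conj_trivial]
    field_simp
  have hproj : y.submodule.starProjection a = (inner ℝ y.rep a / ‖y.rep‖ ^ 2) • y.rep := by
    have : y.submodule = ℝ ∙ y.rep := Projectivization.submodule_eq y
    simp only [this]
    exact Submodule.starProjection_singleton ℝ a
  rw [dP, dR, Real.sin_arccos, ht, hproj]
  have hsq : ‖a - (inner ℝ y.rep a / ‖y.rep‖ ^ 2) • y.rep‖ ^ 2 =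
      ‖a‖ ^ 2 * (1 - (|inner ℝ a y.rep| / (‖a‖ * ‖y.rep‖)) ^ 2) := by
    rw [norm_sub_sq_real, inner_smul_right, norm_smul, Real.norm_eq_abs, mul_pow, sq_abs, div_pow,
      div_pow, sq_abs, real_inner_comm a y.rep]
    field_simp
    ring
  have hnn : 0 ≤ 1 - (|inner ℝ a y.rep| / (‖a‖ * ‖y.rep‖)) ^ 2 := by
    have h0 : 0 ≤ ‖a‖ ^ 2 * (1 - (|inner ℝ a y.rep| / (‖a‖ * ‖y.rep‖)) ^ 2) := by
      rw [← hsq]; positivity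
    exact nonneg_of_mul_nonneg_right h0 (by positivity)
  rw [← sq_eq_sq₀ (by positivity) (norm_nonneg _), hsq, mul_pow, Real.sq_sqrt hnn]

theorem norm_sub_sq_eq_add_of_mem (K : Submodule ℝ (EuclideanSpace ℝ (Fin j)))
    (a : EuclideanSpace ℝ (Fin j)) {c : EuclideanSpace ℝ (Fin j)} (hc : c ∈ K) :
    ‖a - c‖ ^ 2 = ‖a - K.starProjection a‖ ^ 2 + ‖K.starProjection a - c‖ ^ 2 := by
  have h0 : inner ℝ (a - K.starProjection a) (K.starProjection a - c) = 0 :=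
    K.starProjection_inner_eq_zero a _ (K.sub_mem (K.starProjection_apply_mem a) hc)
  have e : a - c = (a - K.starProjection a) + (K.starProjection a - c) := by abel
  rw [e, norm_add_sq_real, h0]
  ring

theorem isNearest_projCone {N : Set (Proj j)} {a : EuclideanSpace ℝ (Fin j)} (ha : a ≠ 0)
    {y : Proj j} (hy : IsClosestPoint N (Projectivization.mk ℝ a ha) y) :
    IsNearest (projCone N) a (y.submodule.starProjection a) := by
  refine ⟨⟨y, hy.1, Submodule.starProjection_apply_mem _ _⟩, ?_⟩
  rintro c ⟨y', hy', hc⟩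
  have h1 := hy.2 y' hy'
  have h2 : ‖a‖ * dP (Projectivization.mk ℝ a ha) y ≤ ‖a‖ * dP (Projectivization.mk ℝ a ha) y' := by
    gcongr
  rw [norm_mul_dP_mk, norm_mul_dP_mk] at h2
  refine h2.trans ?_
  rw [← sq_le_sq₀ (norm_nonneg _) (norm_nonneg _), norm_sub_sq_eq_add_of_mem _ a hc]
  nlinarith [sq_nonneg ‖y'.submodule.starProjection a - c‖]

/-- A nearest point of the cone lies on a closest line, and is the projection onto it. -/
theorem exists_isClosestPoint_of_isNearest {N : Set (Proj j)} {a : EuclideanSpace ℝ (Fin j)}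
    (ha : a ≠ 0) {c : EuclideanSpace ℝ (Fin j)} (hc : IsNearest (projCone N) a c)
    {y : Proj j} (hy : y ∈ N) (hcy : c ∈ y.submodule) :
    IsClosestPoint N (Projectivization.mk ℝ a ha) y ∧ c = y.submodule.starProjection a := by
  have ha' : 0 < ‖a‖ := norm_pos_iff.2 ha
  have hmin : ∀ y' ∈ N, ‖a - c‖ ≤ ‖a - y'.submodule.starProjection a‖ := fun y' hy' =>
    hc.2 _ ⟨y', hy', Submodule.starProjection_apply_mem _ _⟩
  have h1 := norm_sub_sq_eq_add_of_mem y.submodule a hcy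
  have h2 : ‖a - c‖ ^ 2 ≤ ‖a - y.submodule.starProjection a‖ ^ 2 := by
    have := hmin y hy
    gcongr
  have h3 : ‖y.submodule.starProjection a - c‖ ^ 2 = 0 :=
    le_antisymm (by linarith) (sq_nonneg _)
  have h4 : c = y.submodule.starProjection a := by
    rw [sq_eq_zero_iff, norm_eq_zero, sub_eq_zero] at h3
    exact h3.symm
  refine ⟨⟨hy, fun x hx => ?_⟩, h4⟩
  refine le_of_mul_le_mul_left ?_ ha'
  rw [norm_mul_dP_mk, norm_mul_dP_mk, ← h4]
  exact hmin x hx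

/-- The nearest point of `a` in the cone over `N`, for a vector `a` over the region of unique
closest points. -/
def conePoint (N : Set (Proj j)) (a : EuclideanSpace ℝ (Fin j)) : EuclideanSpace ℝ (Fin j) :=
  open Classical in if h : ∃ c, IsNearest (projCone N) a c then h.choose else 0

theorem existsUnique_of_mem_vectorLift {N : Set (Proj j)} {a : EuclideanSpace ℝ (Fin j)}
    (ha : a ∈ vectorLift (uniqueClosestRegion N)) :
    ∃ h : a ≠ 0, ∃! y, IsClosestPoint N (Projectivization.mk ℝ a h) y :=
  ⟨ha.1, interior_subset (s := {x | ∃! y, IsClosestPoint N x y}) ha.2⟩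

theorem isNearest_conePoint {N : Set (Proj j)} {a : EuclideanSpace ℝ (Fin j)}
    (ha : a ∈ vectorLift (uniqueClosestRegion N)) : IsNearest (projCone N) a (conePoint N a) := by
  obtain ⟨h, y, hy, -⟩ := existsUnique_of_mem_vectorLift ha
  have hex : ∃ c, IsNearest (projCone N) a c := ⟨_, isNearest_projCone h hy⟩
  rw [conePoint, dif_pos hex]
  exact hex.choose_spec

/-- Every nearest point lies on a closest line and is the projection of `a` onto it; uniqueness of
that line gives uniqueness of the point, even when it is the vertex `0`. -/
theorem eq_conePoint {N : Set (Proj j)} {a : EuclideanSpace ℝ (Fin j)}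
    (ha : a ∈ vectorLift (uniqueClosestRegion N)) {c : EuclideanSpace ℝ (Fin j)}
    (hc : IsNearest (projCone N) a c) : c = conePoint N a := by
  obtain ⟨h, y, hy, huniq⟩ := existsUnique_of_mem_vectorLift ha
  have key : ∀ c, IsNearest (projCone N) a c → c = y.submodule.starProjection a := by
    intro c hc
    obtain ⟨y', hy', hcy'⟩ := hc.1
    obtain ⟨h1, h2⟩ := exists_isClosestPoint_of_isNearest h hc hy' hcy'
    rw [huniq y' h1] at h2
    exact h2
  rw [key c hc, key _ (isNearest_conePoint ha)]

theorem inner_sub_conePoint {N : Set (Proj j)} {a : EuclideanSpace ℝ (Fin j)}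
    (ha : a ∈ vectorLift (uniqueClosestRegion N)) :
    inner ℝ (a - conePoint N a) (conePoint N a) = 0 := by
  obtain ⟨h, y, hy, -⟩ := existsUnique_of_mem_vectorLift ha
  rw [← eq_conePoint ha (isNearest_projCone h hy)]
  exact Submodule.starProjection_inner_eq_zero _ _ (Submodule.starProjection_apply_mem _ _)

/-- The infimum is attained over the region of unique closest points, so no default value of `sInf`
intervenes. -/
theorem norm_mul_dPSet_mk {N : Set (Proj j)} {a : EuclideanSpace ℝ (Fin j)}
    (ha : a ∈ vectorLift (uniqueClosestRegion N)) (h : a ≠ 0) :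
    ‖a‖ * dPSet (Projectivization.mk ℝ a h) N = infDist a (projCone N) := by
  obtain ⟨_, y, hy, -⟩ := existsUnique_of_mem_vectorLift ha
  have hleast : IsLeast (dP (Projectivization.mk ℝ a h) '' N) (dP (Projectivization.mk ℝ a h) y) :=
    ⟨⟨y, hy.1, rfl⟩, by rintro _ ⟨y', hy', rfl⟩; exact hy.2 y' hy'⟩
  rw [dPSet, hleast.csInf_eq, norm_mul_dP_mk, (isNearest_projCone h hy).infDist_eq]

theorem isOpen_vectorLift_uniqueClosestRegion (N : Set (Proj j)) :
    IsOpen (vectorLift (uniqueClosestRegion N)) :=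
  isOpen_vectorLift.2 isOpen_interior

theorem mem_projCone_iff {N : Set (Proj j)} {a : EuclideanSpace ℝ (Fin j)} (h : a ≠ 0) :
    a ∈ projCone N ↔ Projectivization.mk ℝ a h ∈ N := by
  constructor
  · rintro ⟨y, hy, hay⟩
    rw [Projectivization.submodule_eq, Submodule.mem_span_singleton] at hay
    obtain ⟨t, ht⟩ := hay
    have : Projectivization.mk ℝ a h = y := by
      rw [← y.mk_rep, Projectivization.mk_eq_mk_iff']
      exact ⟨t, ht⟩
    rwa [this]
  · intro hN
    refine ⟨_, hN, ?_⟩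
    rw [Projectivization.submodule_mk]
    exact Submodule.mem_span_singleton_self a

theorem infDist_eq_zero_iff_mem {N : Set (Proj j)} {a : EuclideanSpace ℝ (Fin j)}
    (ha : a ∈ vectorLift (uniqueClosestRegion N)) (h : a ≠ 0) :
    infDist a (projCone N) = 0 ↔ Projectivization.mk ℝ a h ∈ N := by
  rw [← mem_projCone_iff h]
  constructor
  · intro h0
    have hn := isNearest_conePoint ha
    rw [hn.infDist_eq, norm_eq_zero, sub_eq_zero] at h0
    rw [h0]
    exact hn.1
  · exact infDist_zero_of_mem

/-- Although `N` may fail to be closed, minima are attained over the region, so `N` is there the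
zero set of the continuous distance to the cone. -/
theorem isOpen_uniqueClosestRegion_diff (N : Set (Proj j)) :
    IsOpen (uniqueClosestRegion N \ N) := by
  rw [← isOpen_vectorLift]
  have : vectorLift (uniqueClosestRegion N \ N) = vectorLift (uniqueClosestRegion N) ∩
      {a | infDist a (projCone N) ≠ 0} := by
    ext a
    constructor
    · rintro ⟨h, hU, hN⟩
      exact ⟨⟨h, hU⟩, fun h0 => hN ((infDist_eq_zero_iff_mem ⟨h, hU⟩ h).1 h0)⟩
    · rintro ⟨⟨h, hU⟩, h0⟩
      exact ⟨h, hU, fun hN => h0 ((infDist_eq_zero_iff_mem ⟨h, hU⟩ h).2 hN)⟩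
  rw [this]
  exact (isOpen_vectorLift_uniqueClosestRegion N).inter
    (isOpen_ne_fun (continuous_infDist_pt _) continuous_const)

/-! ### The cone as a `C²` submanifold, and regularity of its squared distance -/

/-- The affine chart centred at `z`, as a function of vectors. -/
def affineCoord (z : UnitVec j) (y : EuclideanSpace ℝ (Fin j)) : Perp z :=
  (ℝ ∙ (z : EuclideanSpace ℝ (Fin j)))ᗮ.orthogonalProjectionOnto
    ((inner ℝ (z : EuclideanSpace ℝ (Fin j)) y)⁻¹ • y)

theorem add_affineCoord (z : UnitVec j) {y : EuclideanSpace ℝ (Fin j)}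
    (hy : inner ℝ (z : EuclideanSpace ℝ (Fin j)) y ≠ 0) :
    (z : EuclideanSpace ℝ (Fin j)) + affineCoord z y =
      (inner ℝ (z : EuclideanSpace ℝ (Fin j)) y)⁻¹ • y :=
  add_proj_perp_of_inner_eq_one z (by rw [inner_smul_right, inv_mul_cancel₀ hy])

theorem inner_smul_add_perp (z : UnitVec j) (t : ℝ) (v : Perp z) :
    inner ℝ (z : EuclideanSpace ℝ (Fin j)) (t • ((z : EuclideanSpace ℝ (Fin j)) + v)) = t := by
  rw [inner_smul_right, inner_add_perp, mul_one]

theorem affineCoord_smul_add (z : UnitVec j) {t : ℝ} (ht : t ≠ 0) (v : Perp z) :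
    affineCoord z (t • ((z : EuclideanSpace ℝ (Fin j)) + v)) = v := by
  have h := add_affineCoord z (y := t • ((z : EuclideanSpace ℝ (Fin j)) + v))
    (by rwa [inner_smul_add_perp])
  rw [inner_smul_add_perp, smul_smul, inv_mul_cancel₀ ht, one_smul] at h
  exact Subtype.ext (add_left_cancel h)

theorem contDiffAt_affineCoord (z : UnitVec j) {y : EuclideanSpace ℝ (Fin j)}
    (hy : inner ℝ (z : EuclideanSpace ℝ (Fin j)) y ≠ 0) : ContDiffAt ℝ 2 (affineCoord z) y := by
  have h1 : ContDiffAt ℝ 2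
      (fun y => (inner ℝ (z : EuclideanSpace ℝ (Fin j)) y)⁻¹ • y) y := by
    refine ContDiffAt.smul (ContDiffAt.inv ?_ hy) contDiffAt_id
    exact contDiffAt_const.inner ℝ contDiffAt_id
  exact ((ℝ ∙ (z : EuclideanSpace ℝ (Fin j)))ᗮ.orthogonalProjectionOnto).contDiff.contDiffAt.comp
    y h1

theorem smul_add_mem_projCone {N : Set (Proj j)} {z : UnitVec j} {v : Perp z}
    (hv : (affineChart z).symm v ∈ N) (t : ℝ) :
    t • ((z : EuclideanSpace ℝ (Fin j)) + v) ∈ projCone N := by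
  refine ⟨_, hv, Submodule.smul_mem _ _ ?_⟩
  change (z : EuclideanSpace ℝ (Fin j)) + v ∈
    (Projectivization.mk ℝ ((z : EuclideanSpace ℝ (Fin j)) + v) (add_perp_ne_zero z v)).submodule
  rw [Projectivization.submodule_mk]
  exact Submodule.mem_span_singleton_self _

theorem mk_eq_symm_affineCoord (z : UnitVec j) {y : EuclideanSpace ℝ (Fin j)} (h : y ≠ 0)
    (hy : inner ℝ (z : EuclideanSpace ℝ (Fin j)) y ≠ 0) :
    (affineChart z).symm (affineCoord z y) = Projectivization.mk ℝ y h := by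
  change Projectivization.mk ℝ _ _ = _
  rw [Projectivization.mk_eq_mk_iff']
  exact ⟨_, (add_affineCoord z hy).symm⟩

/-- The cone over a `C²` submanifold of projective space is a `C²` submanifold away from the
origin. -/
theorem exists_isC2ParamAt_of_ne_zero {N : Set (Proj j)} (hN : IsC2Submanifold N)
    {p : EuclideanSpace ℝ (Fin j)} (hp : p ∈ projCone N) (hp0 : p ≠ 0) :
    ∃ (z : UnitVec j) (F : Submodule ℝ (Perp z)) (q : ℝ × F → EuclideanSpace ℝ (Fin j))
      (τ : EuclideanSpace ℝ (Fin j) → ℝ × F) (θ : ℝ × F), IsC2ParamAt (projCone N) p q τ θ := by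
  have hpn : 0 < ‖p‖ := norm_pos_iff.2 hp0
  -- Centring the chart on the line of `p` gives `p` the affine coordinate `0` and height `‖p‖`.
  let z : UnitVec j := ⟨‖p‖⁻¹ • p, by
    rw [mem_sphere_zero_iff_norm, norm_smul, norm_inv, norm_norm, inv_mul_cancel₀ hpn.ne']⟩
  have hzp : p = ‖p‖ • ((z : EuclideanSpace ℝ (Fin j)) + (0 : Perp z)) := by
    rw [Submodule.coe_zero, add_zero, smul_smul, mul_inv_cancel₀ hpn.ne', one_smul]
  have hin : inner ℝ (z : EuclideanSpace ℝ (Fin j)) p = ‖p‖ := by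
    conv_lhs => rw [hzp]
    exact inner_smul_add_perp z _ _
  have hcoord0 : affineCoord z p = 0 := by
    conv_lhs => rw [hzp]
    exact affineCoord_smul_add z hpn.ne' 0
  have h0 : (0 : Perp z) ∈ (affineChart z).symm ⁻¹' N := by
    rw [Set.mem_preimage, ← hcoord0, mk_eq_symm_affineCoord z hp0 (by rw [hin]; exact hpn.ne')]
    exact (mem_projCone_iff hp0).1 hp
  obtain ⟨F, Φ, hsrc, hΦ, hΦ', hF⟩ := hN z 0 h0
  have hΦ0 : Φ 0 ∈ F := (hF 0 hsrc).1 h0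
  have htgt : Φ 0 ∈ Φ.target := Φ.map_source hsrc
  have hcΦ : ContDiffAt ℝ 2 Φ 0 := hΦ.contDiffAt (Φ.open_source.mem_nhds hsrc)
  have hcΦ' : ContDiffAt ℝ 2 Φ.symm (Φ 0) := hΦ'.contDiffAt (Φ.open_target.mem_nhds htgt)
  have hinv0 : Φ.symm (Φ 0) = 0 := Φ.left_inv hsrc
  -- The parameters are the height `⟨z, y⟩` along the ray and the straightened chart coordinate. The
  -- projection onto `F` only serves to define `τ` off the cone; on the cone near `p` it changes
  -- nothing.
  refine ⟨z, F, fun ϑ => ϑ.1 • ((z : EuclideanSpace ℝ (Fin j)) + Φ.symm ϑ.2),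
    fun y => (inner ℝ (z : EuclideanSpace ℝ (Fin j)) y,
      F.orthogonalProjectionOnto (Φ (affineCoord z y))), (‖p‖, ⟨Φ 0, hΦ0⟩), ?_⟩
  have hsnd : Tendsto (fun ϑ : ℝ × F => (ϑ.2 : Perp z)) (𝓝 (‖p‖, ⟨Φ 0, hΦ0⟩)) (𝓝 (Φ 0)) :=
    (continuous_subtype_val.comp continuous_snd).tendsto _
  have hevT : ∀ᶠ ϑ : ℝ × F in 𝓝 (‖p‖, ⟨Φ 0, hΦ0⟩), (ϑ.2 : Perp z) ∈ Φ.target :=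
    hsnd.eventually (Φ.open_target.mem_nhds htgt)
  have hcc := contDiffAt_affineCoord z (y := p) (by rw [hin]; exact hpn.ne')
  have hpos : ∀ᶠ y in 𝓝 p, 0 < inner ℝ (z : EuclideanSpace ℝ (Fin j)) y := by
    have hc : Continuous fun y => inner ℝ (z : EuclideanSpace ℝ (Fin j)) y := by fun_prop
    exact hc.continuousAt.eventually (lt_mem_nhds (by simpa only [hin] using hpn))
  constructor
  · have h1 : ContDiffAt ℝ 2 (fun ϑ : ℝ × F => Φ.symm ϑ.2) (‖p‖, ⟨Φ 0, hΦ0⟩) :=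
      ContDiffAt.comp (g := Φ.symm) (f := fun ϑ : ℝ × F => (ϑ.2 : Perp z)) (‖p‖, ⟨Φ 0, hΦ0⟩) hcΦ'
        (F.subtypeL.contDiff.contDiffAt.comp _ contDiffAt_snd)
    have h2 : ContDiffAt ℝ 2 (fun ϑ : ℝ × F => ((Φ.symm ϑ.2 : Perp z) : EuclideanSpace ℝ (Fin j)))
        (‖p‖, ⟨Φ 0, hΦ0⟩) :=
      ((ℝ ∙ (z : EuclideanSpace ℝ (Fin j)))ᗮ.subtypeL).contDiff.contDiffAt.comp _ h1
    exact contDiffAt_fst.smul (contDiffAt_const.add h2)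
  · simp only [hinv0]
    exact hzp.symm
  · simp only [hin, hcoord0]
    exact Prod.ext rfl (F.orthogonalProjectionOnto_mem_subspace_eq_self ⟨Φ 0, hΦ0⟩)
  · filter_upwards [hevT] with ϑ hϑ
    refine smul_add_mem_projCone ?_ _
    have := hF _ (Φ.map_target hϑ)
    rw [Φ.right_inv hϑ] at this
    exact this.2 ϑ.2.2
  · have h1 : DifferentiableAt ℝ (fun y => Φ (affineCoord z y)) p := by
      have hcΦ1 : DifferentiableAt ℝ Φ (affineCoord z p) := by
        rw [hcoord0]; exact hcΦ.differentiableAt two_ne_zero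
      exact hcΦ1.comp p (hcc.differentiableAt two_ne_zero)
    have h2 : DifferentiableAt ℝ
        (fun y => F.orthogonalProjectionOnto (Φ (affineCoord z y))) p :=
      F.orthogonalProjectionOnto.differentiableAt.comp p h1
    have h3 : DifferentiableAt ℝ (fun y => inner ℝ (z : EuclideanSpace ℝ (Fin j)) y) p :=
      (innerSL ℝ (z : EuclideanSpace ℝ (Fin j))).differentiableAt
    exact h3.prodMk h2
  · have hfst : Tendsto (fun ϑ : ℝ × F => ϑ.1) (𝓝 (‖p‖, ⟨Φ 0, hΦ0⟩)) (𝓝 ‖p‖) :=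
      continuous_fst.tendsto _
    filter_upwards [hevT, hfst.eventually (lt_mem_nhds hpn)] with ϑ hϑ hϑ1
    refine Prod.ext (inner_smul_add_perp z _ _) ?_
    simp only [affineCoord_smul_add z hϑ1.ne', Φ.right_inv hϑ]
    exact F.orthogonalProjectionOnto_mem_subspace_eq_self ϑ.2
  · have hs : ∀ᶠ y in 𝓝 p, affineCoord z y ∈ Φ.source :=
      hcc.continuousAt.eventually (Φ.open_source.mem_nhds (by rw [hcoord0]; exact hsrc))
    filter_upwards [hpos, hs] with y hy hys hyC
    have hy0 : y ≠ 0 := by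
      rintro rfl
      simp at hy
    have hyN : affineCoord z y ∈ (affineChart z).symm ⁻¹' N := by
      rw [Set.mem_preimage, mk_eq_symm_affineCoord z hy0 hy.ne']
      exact (mem_projCone_iff hy0).1 hyC
    have hyF := (hF _ hys).1 hyN
    have e : (F.orthogonalProjectionOnto (Φ (affineCoord z y)) : Perp z) = Φ (affineCoord z y) :=
      congrArg Subtype.val (F.orthogonalProjectionOnto_mem_subspace_eq_self ⟨_, hyF⟩)
    simp only [e, Φ.left_inv hys]
    rw [add_affineCoord z hy.ne', smul_smul, mul_inv_cancel₀ hy.ne', one_smul]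

theorem contDiffAt_infDist_projCone_sq {N : Set (Proj j)} (hN : IsC2Submanifold N)
    {a : EuclideanSpace ℝ (Fin j)} (ha : a ∈ vectorLift (uniqueClosestRegion N)) :
    ContDiffAt ℝ 2 (fun y => infDist y (projCone N) ^ 2) a := by
  have hV := isOpen_vectorLift_uniqueClosestRegion N
  have hP : ∀ x ∈ vectorLift (uniqueClosestRegion N), IsNearest (projCone N) x (conePoint N x) :=
    fun x hx => isNearest_conePoint hx
  have huniq : ∀ x ∈ vectorLift (uniqueClosestRegion N), ∀ q, IsNearest (projCone N) x q →
      q = conePoint N x := fun x hx q hq => eq_conePoint hx hq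
  -- The vertex belongs to every line of the cone. If it is the nearest point, then every line of
  -- `N` is closest, so `N` is a single line and the cone is a linear subspace; otherwise the
  -- nearest point is away from the vertex.
  by_cases h0 : conePoint N a = 0
  · obtain ⟨h, y, hy, hyuniq⟩ := existsUnique_of_mem_vectorLift ha
    have hn := hP a ha
    rw [h0] at hn
    have hcone : projCone N = y.submodule := by
      ext c
      constructor
      · rintro ⟨y', hy', hc⟩
        have := hyuniq y'
          (exists_isClosestPoint_of_isNearest h hn hy' (Submodule.zero_mem _)).1
        rwa [this] at hc
      · exact fun hc => ⟨y, hy.1, hc⟩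
    refine contDiffAt_infDist_sq hV hP huniq ha (q := fun c : y.submodule => (c : _))
      (τ := fun x => y.submodule.orthogonalProjectionOnto x) (θ := 0) ?_
    have hself : ∀ c : y.submodule, y.submodule.orthogonalProjectionOnto (c : _) = c :=
      fun c => y.submodule.orthogonalProjectionOnto_mem_subspace_eq_self c
    rw [h0]
    constructor
    · exact y.submodule.subtypeL.contDiff.contDiffAt
    · rfl
    · exact map_zero _
    · exact Eventually.of_forall fun c => by rw [hcone]; exact c.2
    · exact y.submodule.orthogonalProjectionOnto.differentiableAt
    · exact Eventually.of_forall hself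
    · refine Eventually.of_forall fun x hx => ?_
      rw [hcone] at hx
      exact congrArg Subtype.val (hself ⟨x, hx⟩)
  · obtain ⟨z, F, q, τ, θ, hq⟩ := exists_isC2ParamAt_of_ne_zero hN (hP a ha).1 h0
    exact contDiffAt_infDist_sq hV hP huniq ha hq

/-! ### The section of the sphere in an affine chart -/

theorem norm_sphereSection (z : UnitVec j) (v : Perp z) : ‖sphereSection z v‖ = 1 := by
  have h := norm_pos_iff.2 (add_perp_ne_zero z v)
  rw [sphereSection, norm_smul, norm_inv, norm_norm, inv_mul_cancel₀ h.ne']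

theorem sphereSection_ne_zero (z : UnitVec j) (v : Perp z) : sphereSection z v ≠ 0 := by
  rw [← norm_pos_iff, norm_sphereSection]
  exact one_pos

theorem mk_sphereSection (z : UnitVec j) (v : Perp z) :
    Projectivization.mk ℝ (sphereSection z v) (sphereSection_ne_zero z v) =
      (affineChart z).symm v := by
  change _ = Projectivization.mk ℝ _ (add_perp_ne_zero z v)
  rw [Projectivization.mk_eq_mk_iff']
  exact ⟨_, rfl⟩

theorem sphereSection_mem_vectorLift {W : Set (Proj j)} {z : UnitVec j} {v : Perp z}
    (hv : (affineChart z).symm v ∈ W) : sphereSection z v ∈ vectorLift W :=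
  ⟨sphereSection_ne_zero z v, by rwa [mk_sphereSection]⟩

theorem contDiff_sphereSection (z : UnitVec j) : ContDiff ℝ 2 (sphereSection z) := by
  have h1 : ContDiff ℝ 2 (fun v : Perp z => (z : EuclideanSpace ℝ (Fin j)) + v) :=
    contDiff_const.add ((ℝ ∙ (z : EuclideanSpace ℝ (Fin j)))ᗮ.subtypeL).contDiff
  exact ((h1.norm ℝ (add_perp_ne_zero z)).inv fun v =>
    (norm_pos_iff.2 (add_perp_ne_zero z v)).ne').smul h1

theorem fderiv_sphereSection_apply (z : UnitVec j) (v w : Perp z) :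
    fderiv ℝ (sphereSection z) v w =
      ‖(z : EuclideanSpace ℝ (Fin j)) + v‖⁻¹ • ((w : EuclideanSpace ℝ (Fin j)) -
        (inner ℝ ((z : EuclideanSpace ℝ (Fin j)) + v) (w : EuclideanSpace ℝ (Fin j)) /
          ‖(z : EuclideanSpace ℝ (Fin j)) + v‖ ^ 2) • ((z : EuclideanSpace ℝ (Fin j)) + v)) := by
  set y := (z : EuclideanSpace ℝ (Fin j)) + v with hy
  have hy0 : 0 < ‖y‖ := norm_pos_iff.2 (add_perp_ne_zero z v)
  have hline : HasDerivAt (fun t : ℝ => v + t • w) w 0 := by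
    simpa using ((hasDerivAt_id (0 : ℝ)).smul_const w).const_add v
  have hs : HasFDerivAt (sphereSection z) (fderiv ℝ (sphereSection z) v) (v + (0 : ℝ) • w) := by
    simpa using ((contDiff_sphereSection z).contDiffAt.differentiableAt two_ne_zero).hasFDerivAt
  have h1 : HasDerivAt (fun t : ℝ => sphereSection z (v + t • w))
      (fderiv ℝ (sphereSection z) v w) 0 := by
    have h := HasFDerivAt.comp_hasDerivAt (0 : ℝ) hs hline
    exact h
  have h2 : HasDerivAt (fun t : ℝ => y + t • (w : EuclideanSpace ℝ (Fin j))) w 0 := by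
    simpa using ((hasDerivAt_id (0 : ℝ)).smul_const (w : EuclideanSpace ℝ (Fin j))).const_add y
  have h3 : HasDerivAt (fun t : ℝ => ‖y + t • (w : EuclideanSpace ℝ (Fin j))‖)
      (inner ℝ y (w : EuclideanSpace ℝ (Fin j)) / ‖y‖) 0 := by
    have h := h2.norm_sq.sqrt (by simpa using hy0.ne')
    simp only [zero_smul, add_zero, Real.sqrt_sq (norm_nonneg _)] at h
    convert h using 1
    field_simp
  have h4 := (h3.inv (by simpa using hy0.ne')).smul h2
  simp only [zero_smul, add_zero] at h4
  have h5 : (fun t : ℝ => sphereSection z (v + t • w)) =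
      fun t : ℝ => ‖y + t • (w : EuclideanSpace ℝ (Fin j))‖⁻¹ •
        (y + t • (w : EuclideanSpace ℝ (Fin j))) := by
    funext t
    simp only [sphereSection, hy, Submodule.coe_add, Submodule.coe_smul, add_assoc]
  rw [h5] at h1
  refine (h1.unique h4).trans ?_
  rw [smul_sub, smul_smul, sub_eq_add_neg, ← neg_smul]
  congr 2
  simp only [Pi.inv_apply, zero_smul, add_zero]
  field_simp

/-- The tangent space of the sphere is the image of the derivative of the section. -/
theorem exists_fderiv_sphereSection_eq (z : UnitVec j) (v : Perp z) {η : EuclideanSpace ℝ (Fin j)}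
    (hη : inner ℝ (sphereSection z v) η = 0) : ∃ w, fderiv ℝ (sphereSection z) v w = η := by
  set y := (z : EuclideanSpace ℝ (Fin j)) + v with hy
  have hy0 : 0 < ‖y‖ := norm_pos_iff.2 (add_perp_ne_zero z v)
  have hyη : inner ℝ y η = 0 := by
    rw [sphereSection, inner_smul_left] at hη
    rcases mul_eq_zero.1 hη with h | h
    · simp only [conj_trivial] at h
      exact absurd h (inv_ne_zero hy0.ne')
    · exact h
  -- The derivative of `y ↦ ‖y‖⁻¹ • y` kills `y` and divides vectors orthogonal to `y` by `‖y‖`. So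
  -- rescale `η` by `‖y‖`, after subtracting the multiple of `y` that makes it orthogonal to `z`,
  -- using `⟨z, y⟩ = 1`.
  let w : Perp z := ⟨‖y‖ • (η - inner ℝ (z : EuclideanSpace ℝ (Fin j)) η • y), by
    rw [Submodule.mem_orthogonal_singleton_iff_inner_right, inner_smul_right, inner_sub_right,
      inner_smul_right, hy, inner_add_perp]
    ring⟩
  refine ⟨w, ?_⟩
  rw [fderiv_sphereSection_apply]
  have hyw : inner ℝ y (w : EuclideanSpace ℝ (Fin j)) =
      -(‖y‖ ^ 3 * inner ℝ (z : EuclideanSpace ℝ (Fin j)) η) := by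
    change inner ℝ y (‖y‖ • (η - inner ℝ (z : EuclideanSpace ℝ (Fin j)) η • y)) = _
    rw [inner_smul_right, inner_sub_right, inner_smul_right, hyη, real_inner_self_eq_norm_sq]
    ring
  rw [← hy, hyw]
  change ‖y‖⁻¹ • (‖y‖ • (η - inner ℝ (z : EuclideanSpace ℝ (Fin j)) η • y) - _) = η
  have e : -(‖y‖ ^ 3 * inner ℝ (z : EuclideanSpace ℝ (Fin j)) η) / ‖y‖ ^ 2 =
      -(‖y‖ * inner ℝ (z : EuclideanSpace ℝ (Fin j)) η) := by
    field_simp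
  rw [e, neg_smul, sub_neg_eq_add, smul_sub, smul_smul, sub_add_cancel, smul_smul,
    inv_mul_cancel₀ hy0.ne', one_smul]

theorem dPSet_symm_eq_infDist {N : Set (Proj j)} {z : UnitVec j} {v : Perp z}
    (hv : (affineChart z).symm v ∈ uniqueClosestRegion N) :
    dPSet ((affineChart z).symm v) N = infDist (sphereSection z v) (projCone N) := by
  have h := norm_mul_dPSet_mk (sphereSection_mem_vectorLift hv) (sphereSection_ne_zero z v)
  rwa [mk_sphereSection, norm_sphereSection, one_mul] at h

theorem infDist_sphereSection_pos {N : Set (Proj j)} {z : UnitVec j} {v : Perp z}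
    (hv : (affineChart z).symm v ∈ uniqueClosestRegion N \ N) :
    0 < infDist (sphereSection z v) (projCone N) := by
  refine lt_of_le_of_ne infDist_nonneg fun h0 => hv.2 ?_
  have := (infDist_eq_zero_iff_mem (sphereSection_mem_vectorLift hv.1)
    (sphereSection_ne_zero z v)).1 h0.symm
  rwa [mk_sphereSection] at this

theorem continuous_symm_affineChart (z : UnitVec j) : Continuous (affineChart z).symm := by
  have h1 : Continuous (Projectivization.mk' ℝ :
      {v : EuclideanSpace ℝ (Fin j) // v ≠ 0} → Proj j) := continuous_coinduced_rng
  have h2 : Continuous fun v : Perp z =>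
      (⟨(z : EuclideanSpace ℝ (Fin j)) + v, add_perp_ne_zero z v⟩ :
        {v : EuclideanSpace ℝ (Fin j) // v ≠ 0}) :=
    (continuous_const.add continuous_subtype_val).subtype_mk _
  exact h1.comp h2

theorem isOpen_source_affineChart (z : UnitVec j) : IsOpen (affineChart z).source := by
  rw [← isOpen_vectorLift]
  have : vectorLift (affineChart z).source =
      {a | inner ℝ (z : EuclideanSpace ℝ (Fin j)) a ≠ 0} := by
    ext a
    constructor
    · rintro ⟨h, hs⟩
      change inner ℝ (z : EuclideanSpace ℝ (Fin j)) (Projectivization.mk ℝ a h).rep ≠ 0 at hs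
      obtain ⟨u, hu⟩ := Projectivization.exists_smul_eq_mk_rep ℝ a h
      rw [← hu, Units.smul_def, inner_smul_right] at hs
      exact right_ne_zero_of_mul hs
    · intro ha
      have h : a ≠ 0 := by
        rintro rfl
        exact ha (inner_zero_right _)
      refine ⟨h, ?_⟩
      change inner ℝ (z : EuclideanSpace ℝ (Fin j)) (Projectivization.mk ℝ a h).rep ≠ 0
      obtain ⟨u, hu⟩ := Projectivization.exists_smul_eq_mk_rep ℝ a h
      rw [← hu, Units.smul_def, inner_smul_right]
      exact mul_ne_zero u.ne_zero ha
  rw [this]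
  exact isOpen_ne_fun (by fun_prop) continuous_const

theorem exists_mem_source_affineChart (x : Proj j) :
    ∃ z : UnitVec j, x ∈ (affineChart z).source := by
  have h := norm_pos_iff.2 x.rep_nonzero
  refine ⟨⟨‖x.rep‖⁻¹ • x.rep, by
    rw [mem_sphere_zero_iff_norm, norm_smul, norm_inv, norm_norm, inv_mul_cancel₀ h.ne']⟩, ?_⟩
  change inner ℝ (‖x.rep‖⁻¹ • x.rep) x.rep ≠ 0
  rw [inner_smul_left, real_inner_self_eq_norm_sq]
  simp only [conj_trivial]
  positivity

/-! ### The condition function in charts and its convexity along geodesics -/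

/-- The squared distance to `N`, in the chart centred at `z`. -/
theorem contDiffAt_infDist_sphereSection_sq {N : Set (Proj j)} (hN : IsC2Submanifold N)
    {z : UnitVec j} {v : Perp z} (hv : (affineChart z).symm v ∈ uniqueClosestRegion N) :
    ContDiffAt ℝ 2 (fun v => infDist (sphereSection z v) (projCone N) ^ 2) v :=
  ContDiffAt.comp (g := fun y => infDist y (projCone N) ^ 2) v
    (contDiffAt_infDist_projCone_sq hN (sphereSection_mem_vectorLift hv))
    (contDiff_sphereSection z).contDiffAt

theorem eventually_dPSet_symm_eq {N : Set (Proj j)} {z : UnitVec j} {v : Perp z}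
    (hv : (affineChart z).symm v ∈ uniqueClosestRegion N) :
    (fun v => (dPSet ((affineChart z).symm v) N ^ 2)⁻¹) =ᶠ[𝓝 v]
      fun v => (infDist (sphereSection z v) (projCone N) ^ 2)⁻¹ := by
  filter_upwards [(continuous_symm_affineChart z).continuousAt.eventually
    (isOpen_interior.mem_nhds hv)] with u hu
  rw [dPSet_symm_eq_infDist hu]

theorem contDiffAt_condition {N : Set (Proj j)} (hN : IsC2Submanifold N)
    {z : UnitVec j} {v : Perp z} (hv : (affineChart z).symm v ∈ uniqueClosestRegion N \ N) :
    ContDiffAt ℝ 2 (fun v => (dPSet ((affineChart z).symm v) N ^ 2)⁻¹) v :=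
  ((contDiffAt_infDist_sphereSection_sq hN hv.1).inv
    (pow_pos (infDist_sphereSection_pos hv) 2).ne').congr_of_eventuallyEq
      (eventually_dPSet_symm_eq hv.1)

theorem hasFDerivAt_infDist_projCone_sq {N : Set (Proj j)} {a : EuclideanSpace ℝ (Fin j)}
    (ha : a ∈ vectorLift (uniqueClosestRegion N)) :
    HasFDerivAt (fun y => infDist y (projCone N) ^ 2)
      ((2 : ℝ) • innerSL ℝ (a - conePoint N a)) a := by
  have hV := isOpen_vectorLift_uniqueClosestRegion N
  exact hasFDerivAt_infDist_sq hV (fun x hx => isNearest_conePoint hx) ha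
    (continuousAt_of_unique hV (fun x hx => isNearest_conePoint hx)
      (fun x hx q hq => eq_conePoint hx hq) ha)

theorem fderiv_condition_apply {N : Set (Proj j)}
    {z : UnitVec j} {v : Perp z} (hv : (affineChart z).symm v ∈ uniqueClosestRegion N \ N)
    (w : Perp z) :
    fderiv ℝ (fun v => (dPSet ((affineChart z).symm v) N ^ 2)⁻¹) v w =
      -(2 * inner ℝ (sphereSection z v - conePoint N (sphereSection z v))
        (fderiv ℝ (sphereSection z) v w)) / (infDist (sphereSection z v) (projCone N) ^ 2) ^ 2 := by
  have hs : HasFDerivAt (sphereSection z) (fderiv ℝ (sphereSection z) v) v :=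
    ((contDiff_sphereSection z).contDiffAt.differentiableAt two_ne_zero).hasFDerivAt
  have h1 := (hasFDerivAt_infDist_projCone_sq (sphereSection_mem_vectorLift hv.1)).comp v hs
  have hne : infDist (sphereSection z v) (projCone N) ^ 2 ≠ 0 :=
    (pow_pos (infDist_sphereSection_pos hv) 2).ne'
  have h2 := (hasDerivAt_inv hne).comp_hasFDerivAt v h1
  rw [(eventually_dPSet_symm_eq hv.1).fderiv_eq]
  have h3 : HasFDerivAt (fun v => (infDist (sphereSection z v) (projCone N) ^ 2)⁻¹) _ v := h2
  rw [h3.fderiv]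
  simp only [smul_apply, ContinuousLinearMap.comp_apply, innerSL_apply_apply, smul_eq_mul]
  ring

/-- Convexity of `log α` along the geodesics of the condition metric, infinitesimally. -/
theorem log_condition_along_geodesic {N : Set (Proj j)} (hN : IsC2Submanifold N)
    {γ : ℝ → Proj j} {I : Set ℝ} (hI : IsOpen I)
    (hmaps : Set.MapsTo γ I (uniqueClosestRegion N \ N))
    (hγ : IsGeodesicOn (conditionMetric fun x => (dPSet x N ^ 2)⁻¹) γ I) {t : ℝ} (ht : t ∈ I) :
    ContDiffAt ℝ 2 (fun τ => Real.log ((dPSet (γ τ) N ^ 2)⁻¹)) t ∧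
      0 ≤ deriv (deriv fun τ => Real.log ((dPSet (γ τ) N ^ 2)⁻¹)) t := by
  obtain ⟨z, hz⟩ := exists_mem_source_affineChart (γ t)
  set c : ℝ → Perp z := fun τ => affineChart z (γ τ) with hcdef
  set X : ℝ → EuclideanSpace ℝ (Fin j) := fun τ => sphereSection z (c τ) with hXdef
  set r : ℝ → ℝ := fun τ => infDist (X τ) (projCone N) ^ 2 with hrdef
  have hnhds : I ∩ γ ⁻¹' (affineChart z).source ∈ 𝓝 t :=
    inter_mem (hI.mem_nhds ht) ((hγ.continuousOn.continuousAt (hI.mem_nhds ht)).preimage_mem_nhds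
      ((isOpen_source_affineChart z).mem_nhds hz))
  have hsymm : ∀ τ ∈ γ ⁻¹' (affineChart z).source, (affineChart z).symm (c τ) = γ τ :=
    fun τ hτ => (affineChart z).left_inv hτ
  have hW : ∀ τ ∈ I ∩ γ ⁻¹' (affineChart z).source,
      (affineChart z).symm (c τ) ∈ uniqueClosestRegion N \ N := fun τ hτ => by
    rw [hsymm τ hτ.2]
    exact hmaps hτ.1
  have hWt := hW t (mem_of_mem_nhds hnhds)
  have hlift := sphereSection_mem_vectorLift hWt.1
  have hc : ContDiffAt ℝ 2 c t := (hγ.contDiffOn z).contDiffAt hnhds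
  have hX : ContDiffAt ℝ 2 X t := (contDiff_sphereSection z).contDiffAt.comp t hc
  have hr : ContDiffAt ℝ 2 r t :=
    ContDiffAt.comp (g := fun v => infDist (sphereSection z v) (projCone N) ^ 2) t
      (contDiffAt_infDist_sphereSection_sq hN hWt.1) hc
  have hpos : 0 < r t := pow_pos (infDist_sphereSection_pos hWt) 2
  have hlog : (fun τ => Real.log ((dPSet (γ τ) N ^ 2)⁻¹)) =ᶠ[𝓝 t] fun τ => -Real.log (r τ) := by
    filter_upwards [hnhds] with τ hτ
    rw [← hsymm τ hτ.2, dPSet_symm_eq_infDist (hW τ hτ).1, Real.log_inv]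
  refine ⟨(hr.log hpos.ne').neg.congr_of_eventuallyEq hlog, ?_⟩
  rw [hlog.deriv.deriv_eq]
  refine deriv_deriv_neg_log_nonneg hr hpos ?_
  set p := conePoint N (X t) with hpdef
  have hnear : IsNearest (projCone N) (X t) p := isNearest_conePoint hlift
  have hpX : inner ℝ (X t - p) p = 0 := inner_sub_conePoint hlift
  have heq : r t = ‖X t - p‖ ^ 2 := by rw [hrdef, ← hnear.infDist_eq]
  have hXX : inner ℝ (X t - p) (X t) = r t := by
    have : inner ℝ (X t - p) (X t) = inner ℝ (X t - p) (X t - p) + inner ℝ (X t - p) p := by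
      rw [← inner_add_right, sub_add_cancel]
    rw [this, hpX, heq, real_inner_self_eq_norm_sq, add_zero]
  have hrd : deriv r t = 2 * inner ℝ (X t - p) (deriv X t) := by
    have h := (hasFDerivAt_infDist_projCone_sq hlift).comp_hasDerivAt t
      (hX.differentiableAt two_ne_zero).hasDerivAt
    have h' : HasDerivAt r _ t := h
    rw [h'.deriv]
    simp only [smul_apply, innerSL_apply_apply, smul_eq_mul]
    rfl
  refine mul_deriv_deriv_le_sq hX hr (Eventually.of_forall fun τ => norm_sphereSection z (c τ))
    (Eventually.of_forall fun τ => ?_) heq hpX hpos ?_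
  · have h := infDist_le_dist_of_mem (x := X τ) hnear.1
    rw [dist_eq_norm] at h
    have h0 : 0 ≤ infDist (X τ) (projCone N) := infDist_nonneg
    exact pow_le_pow_left₀ h0 h 2
  -- Since `⟨X - p, X⟩ = r` and `‖X‖ = 1`, the vector `X - p - r X` is the component of `X - p`
  -- tangent to the sphere, hence the image of a chart vector `w` on which the geodesic equation can
  -- be tested.
  · have hη : inner ℝ (X t) (X t - p - r t • X t) = 0 := by
      rw [inner_sub_right, inner_smul_right, real_inner_comm, hXX, real_inner_self_eq_norm_sq,
        norm_sphereSection]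
      ring
    obtain ⟨w, hw⟩ := exists_fderiv_sphereSection_eq z (c t) hη
    have hs2 := (contDiff_sphereSection z).contDiffAt (x := c t)
    have hgeo := geodesicEquation_image hs2
      ((contDiffAt_condition hN hWt).differentiableAt two_ne_zero) hc rfl
      (hγ.geodesicEquation z t ht hz) w
    have hX' : deriv X t = fderiv ℝ (sphereSection z) (c t) (deriv c t) :=
      deriv_comp_eq (hs2.differentiableAt two_ne_zero) (hc.differentiableAt two_ne_zero)
    rw [fderiv_condition_apply hWt, fderiv_condition_apply hWt, hw, ← hX',
      dPSet_symm_eq_infDist hWt.1] at hgeo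
    change (r t)⁻¹ * inner ℝ (deriv (deriv X) t) (X t - p - r t • X t) +
      -(2 * inner ℝ (X t - p) (deriv X t)) / r t ^ 2 *
        inner ℝ (deriv X t) (X t - p - r t • X t) -
      -(2 * inner ℝ (X t - p) (X t - p - r t • X t)) / r t ^ 2 * ‖deriv X t‖ ^ 2 / 2 = 0 at hgeo
    rw [← hrd] at hgeo
    -- Clearing the powers of `r` that come from `α = r⁻¹` leaves the identity in the form used by
    -- `mul_deriv_deriv_le_sq`.
    field_simp at hgeo
    linarith

end ProjectiveSelfConvexity

end

theorem mainTheorem3 (j : ℕ) (N : Set (ProjectiveSelfConvexity.Proj j))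
    (hN : ProjectiveSelfConvexity.IsC2Submanifold N) :
    ProjectiveSelfConvexity.IsSelfConvexOn
      (fun x => (ProjectiveSelfConvexity.dPSet x N ^ 2)⁻¹)
      (ProjectiveSelfConvexity.uniqueClosestRegion N \ N) := by
  refine ⟨ProjectiveSelfConvexity.isOpen_uniqueClosestRegion_diff N, fun x hx => ?_,
    fun z v hv => (ProjectiveSelfConvexity.contDiffAt_condition hN hv).contDiffWithinAt,
    fun γ I hI hconn hmaps hγ => ?_⟩
  · obtain ⟨z, hz⟩ := ProjectiveSelfConvexity.exists_mem_source_affineChart x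
    have hsymm := (ProjectiveSelfConvexity.affineChart z).left_inv hz
    have hx' : (ProjectiveSelfConvexity.affineChart z).symm
        (ProjectiveSelfConvexity.affineChart z x) ∈
        ProjectiveSelfConvexity.uniqueClosestRegion N \ N := by rwa [hsymm]
    have hpos := ProjectiveSelfConvexity.infDist_sphereSection_pos hx'
    rw [← ProjectiveSelfConvexity.dPSet_symm_eq_infDist hx'.1, hsymm] at hpos
    positivity
  · have key := fun t (ht : t ∈ I) =>
      ProjectiveSelfConvexity.log_condition_along_geodesic hN hI hmaps hγ ht
    refine convexOn_of_deriv2_nonneg' (convex_iff_ordConnected.2 hconn)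
      (fun t ht => ((key t ht).1.differentiableAt two_ne_zero).differentiableWithinAt)
      (fun t ht => ?_) (fun t ht => (key t ht).2)
    exact (ProjectiveSelfConvexity.hasDerivAt_deriv_of_contDiffAt
      (key t ht).1).differentiableAt.differentiableWithinAt
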